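/- Let $k$ be an infinite field and let $Sm/k$ be the category of smooth separated $k$-schemes of finite type. *Framed correspondences.* An explicit framed correspondence of level $n$ from $X$ to $Y$ consists of a closed subset $Z\subset X\times\mathbb A^n$ finite over $X$ (the support), an étale neighbourhood $W\to X\times\mathbb A^n$ of $Z$, functions $\varphi_1,\dots,\varphi_n$ on $W$ with common vanishing locus $Z$, and a $k$-morphism $g:W\to Y$. Two of them are equivalent if they have the same support and the functions and the morphisms to $Y$ agree on some common étale neighbourhood of it; $Fr_n(X,Y)$ is the set of equivalence classes. The composite of $(W,\varphi;g)\in Fr_n(X,Y)$ and $(W',\psi;g')\in Fr_m(Y,T)$ is $(W\times_Y W',(\varphi,\psi);g'\circ pr_{W'})\in Fr_{n+m}(X,T)$. A morphism $f:X\to Y$ is regarded as an element of $Fr_0(X,Y)$. Let $\sigma_X=(X\times\mathbb A^1,t;pr_X)\in Fr_1(X,X)$, with support $X\times 0$. Let $\mathbb ZF_n(X,Y)$ be the quotient of the free abelian group on $Fr_n(X,Y)$ by the relations $a=a_1+a_2$ whenever the support of $a$ is a disjoint union $Z_1\sqcup Z_2$ of closed subsets and $a_1,a_2$ are the restrictions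 of $a$ with supports $Z_1,Z_2$. *Pairs.* For pairs $(X,V)$ with $X\in Sm/k$ and $V\subset X$ open let $$\mathbb ZF^{pr}_n((Y,W),(X,V))=\ker\bigl[\mathbb ZF_n(Y,X)\oplus\mathbb ZF_n(W,V)\xrightarrow{\,i_Y^*-i_{X,*}\,}\mathbb ZF_n(W,X)\bigr],$$ where $i_Y:W\hookrightarrow Y$ and $i_X:V\hookrightarrow X$ are the inclusions, with componentwise composition. Let $\overline{\mathbb ZF}{}^{pr}_n((Y,W),(X,V))$ be the cokernel of $i_0^*-i_1^*:\mathbb ZF^{pr}_n(\mathbb A^1\times(Y,W),(X,V))\to\mathbb ZF^{pr}_n((Y,W),(X,V))$, where $\mathbb A^1\times(Y,W)=(\mathbb A^1\times Y,\mathbb A^1\times W)$, and let $\overline{\overline{\mathbb ZF}}_n$ be obtained from $\overline{\mathbb ZF}{}^{pr}_n$ by dividing out the (degree $n$ part of the) two-sided ideal generated by the identity morphisms of all pairs $(X,X)$, $X\in Sm/k$. Write $\overline{[[r]]}$ for the class of $r\in\mathbb ZF^{pr}_n$ in $\overline{\overline{\mathbb ZF}}_n$, and for a pair $(X,V)$ write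 $\overline{[[\sigma_X]]}$ for the class of $(\sigma_X,\sigma_V)$. **Theorem.** Let $V\subset U\subset\mathbb A^1_k$ be open subsets with $V$ non-empty, and let $S\subset V$ be a closed subset of $V$ such that $U-S$ is open in $U$ (this is automatic unless $S=V\neq U$). Let $i:(V,V-S)\to(U,U-S)$ be the inclusion of pairs. Then there are $$r\in\mathbb ZF^{pr}_1((U,U-S),(V,V-S))\quad\text{and}\quad l\in\mathbb ZF^{pr}_1((U,U-S),(V,V-S))$$ such that $$\overline{[[i]]}\circ\overline{[[r]]}=\overline{[[\sigma_U]]}\ \text{ in }\ \overline{\overline{\mathbb ZF}}_1((U,U-S),(U,U-S))$$ and $$\overline{[[l]]}\circ\overline{[[i]]}=\overline{[[\sigma_V]]}\ \text{ in }\ \overline{\overline{\mathbb ZF}}_1((V,V-S),(V,V-S)).$$ -/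

import Mathlib

open CategoryTheory Limits AlgebraicGeometry TopologicalSpace

universe u

namespace FramedCorr

/-! ### Affine space with coordinates indexed by `Fin n` -/

/-- The affine space `𝔸ⁿ` over a scheme `S`. -/
noncomputable abbrev Aff (n : ℕ) (S : Scheme.{u}) : Scheme.{u} := AffineSpace (ULift.{u} (Fin n)) S

/-- The projection `𝔸ⁿ × S ⟶ S`. -/
noncomputable abbrev Aff.pr (n : ℕ) (S : Scheme.{u}) : Aff n S ⟶ S := Aff n S ↘ S

/-- The coordinate functions on `𝔸ⁿ × S`. -/
noncomputable def Aff.x {n : ℕ} (S : Scheme.{u}) (i : Fin n) : Γ(Aff n S, ⊤) :=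
  AffineSpace.coord S (ULift.up i)

/-- The morphism `T ⟶ 𝔸ⁿ × S` given by a morphism `T ⟶ S` and `n` functions on `T`. -/
noncomputable def Aff.lift {n : ℕ} {S T : Scheme.{u}} (f : T ⟶ S) (v : Fin n → Γ(T, ⊤)) :
    T ⟶ Aff n S :=
  AffineSpace.homOfVector f (fun i => v i.down)

@[simp]
lemma Aff.lift_pr {n : ℕ} {S T : Scheme.{u}} (f : T ⟶ S) (v : Fin n → Γ(T, ⊤)) :
    Aff.lift f v ≫ Aff.pr n S = f := AffineSpace.homOfVector_over _ _

@[simp]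
lemma Aff.lift_pr_assoc {n : ℕ} {S T S' : Scheme.{u}} (f : T ⟶ S) (v : Fin n → Γ(T, ⊤))
    (g : S ⟶ S') : Aff.lift f v ≫ Aff.pr n S ≫ g = f ≫ g := by
  rw [← Category.assoc, Aff.lift_pr]

@[simp]
lemma Aff.lift_x {n : ℕ} {S T : Scheme.{u}} (f : T ⟶ S) (v : Fin n → Γ(T, ⊤)) (i : Fin n) :
    (Aff.lift f v).appTop (Aff.x S i) = v i := AffineSpace.homOfVector_appTop_coord _ _ _

lemma appTop_comp_apply {X Y Z : Scheme.{u}} (f : X ⟶ Y) (g : Y ⟶ Z) (s : Γ(Z, ⊤)) :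
    (f ≫ g).appTop s = f.appTop (g.appTop s) := by
  rw [Scheme.Hom.comp_appTop]; rfl

lemma Aff.hom_ext {n : ℕ} {S T : Scheme.{u}} {f g : T ⟶ Aff n S}
    (h : f ≫ Aff.pr n S = g ≫ Aff.pr n S)
    (hx : ∀ i : Fin n, f.appTop (Aff.x S i) = g.appTop (Aff.x S i)) : f = g :=
  AffineSpace.hom_ext h (fun i => hx i.down)

/-- The point `x` lies in the common vanishing locus of the functions `φ 0, …, φ (n - 1)`
(`x` lies in no `D(φ i)`, i.e. no `φ i` is invertible at `x`). -/
def Vanishes {U : Scheme.{u}} {n : ℕ} (φ : Fin n → Γ(U, ⊤)) (x : U) : Prop :=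
  ∀ i, x ∉ U.basicOpen (φ i)

lemma notMem_basicOpen_appTop {U V : Scheme.{u}} (f : V ⟶ U) (s : Γ(U, ⊤)) (x : V) :
    x ∉ V.basicOpen (f.appTop s) ↔ f x ∉ U.basicOpen s := by
  rw [← Scheme.preimage_basicOpen_top]; rfl

/-- The inclusion of a closed subset `Z`, regarded as a closed subscheme with its reduced
structure. -/
noncomputable abbrev redι {A : Scheme.{u}} (Z : Closeds A) :
    (Scheme.IdealSheafData.vanishingIdeal Z).subscheme ⟶ A :=
  (Scheme.IdealSheafData.vanishingIdeal Z).subschemeι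

lemma range_redι {A : Scheme.{u}} (Z : Closeds A) : Set.range (redι Z) = Z := by
  rw [Scheme.IdealSheafData.range_subschemeι, Scheme.IdealSheafData.coe_support_vanishingIdeal]

lemma isClosedImmersion_of_isFinite_comp {A P B : Scheme.{u}} (c : P ⟶ A) (b : A ⟶ B)
    [IsSeparated b] [IsFinite (c ≫ b)] [Mono c] : IsClosedImmersion c := by
  have : IsFinite c := IsFinite.of_comp c b
  exact (IsClosedImmersion.iff_isFinite_and_mono (f := c)).mpr ⟨‹_›, ‹_›⟩

/-- A closed subset `Z` that is the image of a monomorphism `c : P ⟶ A` with `P` finite over `B`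
is finite over `B`, and if `P` is its own preimage under `p : W ⟶ A`, then `p` is an isomorphism
over `Z` (with reduced structures). -/
lemma nbhd_criterion {A W P B : Scheme.{u}} (p : W ⟶ A) (c : P ⟶ A) (q : P ⟶ W) (b : A ⟶ B)
    [IsSeparated b] [IsFinite (c ≫ b)] [Mono c] (hq : IsPullback q (𝟙 P) p c)
    (Z : Closeds A) (hZ : (Z : Set A) = Set.range c) :
    IsFinite (redι Z ≫ b) ∧ IsIso (pullback.snd p (redι Z)) ∧
      (∀ w, p w ∈ Z ↔ w ∈ Set.range q) := by
  have := isClosedImmersion_of_isFinite_comp c b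
  have hle : c.ker ≤ (redι Z).ker := by
    rw [Scheme.IdealSheafData.ker_subschemeι, ← Scheme.IdealSheafData.le_support_iff_le_vanishingIdeal]
    intro x hx
    have := c.support_ker
    change x ∈ (c.ker.support : Set A)
    rw [this]
    exact subset_closure (hZ.subset hx)
  let d := IsClosedImmersion.lift c (redι Z) hle
  have hd : d ≫ c = redι Z := IsClosedImmersion.lift_fac _ _ _
  refine ⟨?_, ?_, ?_⟩
  · have : IsClosedImmersion (d ≫ c) := hd ▸ inferInstance
    have : IsClosedImmersion d := IsClosedImmersion.of_comp_isClosedImmersion d c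
    rw [← hd, Category.assoc]
    infer_instance
  · have h1 : IsPullback (d ≫ q) (𝟙 _) p (redι Z) := by
      rw [← hd]
      exact (IsPullback.of_vert_isIso ⟨by simp⟩).paste_horiz hq
    have h2 := h1.isoPullback_hom_snd
    rw [← h1.isoPullback.eq_inv_comp, Category.comp_id] at h2
    rw [h2]; infer_instance
  · intro w
    constructor
    · intro hw
      obtain ⟨y, hy⟩ := hZ.subset hw
      obtain ⟨z, hz, -⟩ := Scheme.exists_preimage_of_isPullback hq w y hy.symm
      exact ⟨z, hz⟩
    · rintro ⟨y, rfl⟩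
      refine hZ.superset ⟨y, ?_⟩
      rw [← Scheme.Hom.comp_apply, hq.w, Category.id_comp]

/-- Concatenation of two vectors, the total length being given up to a proof of equality. -/
def append {α : Type*} {n m l : ℕ} (h : n + m = l) (v : Fin n → α) (w : Fin m → α) : Fin l → α :=
  fun i => Fin.append v w (Fin.cast h.symm i)

lemma append_left {α : Type*} {n m l : ℕ} (h : n + m = l) (v : Fin n → α) (w : Fin m → α)
    (i : Fin n) : append h v w (Fin.cast h (Fin.castAdd m i)) = v i := by
  subst h; simp [append]

lemma append_right {α : Type*} {n m l : ℕ} (h : n + m = l) (v : Fin n → α) (w : Fin m → α)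
    (i : Fin m) : append h v w (Fin.cast h (Fin.natAdd n i)) = w i := by
  subst h; simp [append]

lemma forall_fin {n m l : ℕ} (h : n + m = l) {P : Fin l → Prop} :
    (∀ i, P i) ↔ (∀ i : Fin n, P (Fin.cast h (Fin.castAdd m i))) ∧
      ∀ i : Fin m, P (Fin.cast h (Fin.natAdd n i)) := by
  subst h
  refine ⟨fun H => ⟨fun i => H _, fun i => H _⟩, fun H i => ?_⟩
  exact Fin.addCases H.1 H.2 i

lemma append_assoc {α : Type*} {n m r l₁ l₂ t : ℕ} (h₁ : n + m = l₁) (h₂ : l₁ + r = t)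
    (h₃ : m + r = l₂) (h₄ : n + l₂ = t) (u : Fin n → α) (v : Fin m → α) (w : Fin r → α) :
    append h₂ (append h₁ u v) w = append h₄ u (append h₃ v w) := by
  subst h₁ h₂ h₃
  funext i
  have := congrFun (Fin.append_assoc u v w) (Fin.cast (by omega) i)
  change Fin.append (fun i => Fin.append u v (Fin.cast _ i)) w (Fin.cast _ i) =
    Fin.append u (fun i => Fin.append v w (Fin.cast _ i)) (Fin.cast _ i)
  simpa using this

lemma append_comp {α β : Type*} {n m l : ℕ} (h : n + m = l) (f : α → β)
    (v : Fin n → α) (w : Fin m → α) (i : Fin l) :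
    f (append h v w i) = append h (fun i => f (v i)) (fun i => f (w i)) i := by
  revert i
  rw [forall_fin h]
  simp [append_left, append_right]

lemma vanishes_append {U : Scheme.{u}} {n m l : ℕ} (h : n + m = l)
    (φ : Fin n → Γ(U, ⊤)) (ψ : Fin m → Γ(U, ⊤)) (x : U) :
    Vanishes (append h φ ψ) x ↔ Vanishes φ x ∧ Vanishes ψ x := by
  simp [Vanishes, forall_fin h, append_left, append_right]

lemma vanishes_pullback {U V : Scheme.{u}} {n : ℕ} (f : V ⟶ U) (φ : Fin n → Γ(U, ⊤)) (x : V) :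
    Vanishes (fun i => f.appTop (φ i)) x ↔ Vanishes φ (f x) := by
  simp only [Vanishes, notMem_basicOpen_appTop]

/-- For `p : U ⟶ 𝔸ⁿ × X`, `g : U ⟶ Y` and `q : V ⟶ 𝔸ᵐ × Y`, the morphism
`U ×_Y V ⟶ 𝔸ⁿ⁺ᵐ × X` whose first `n` affine coordinates (and `X`-component) are those of `p` and
whose last `m` affine coordinates are those of `q`. -/
noncomputable def compMap {n m l : ℕ} (h : n + m = l) {X Y U V : Scheme.{u}} (p : U ⟶ Aff n X)
    (g : U ⟶ Y) (q : V ⟶ Aff m Y) : pullback g (q ≫ Aff.pr m Y) ⟶ Aff l X :=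
  Aff.lift (pullback.fst g (q ≫ Aff.pr m Y) ≫ p ≫ Aff.pr n X)
    (append h (fun i => (pullback.fst g (q ≫ Aff.pr m Y) ≫ p).appTop (Aff.x X i))
      (fun j => (pullback.snd g (q ≫ Aff.pr m Y) ≫ q).appTop (Aff.x Y j)))

lemma isIso_lift_append {n m l : ℕ} (h : n + m = l) (X : Scheme.{u}) :
    IsIso (Aff.lift (Aff.pr m (Aff n X) ≫ Aff.pr n X)
      (append h (fun i => (Aff.pr m (Aff n X)).appTop (Aff.x X i))
        (fun j => Aff.x (Aff n X) j)) : Aff m (Aff n X) ⟶ Aff l X) := by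
  refine ⟨Aff.lift (Aff.lift (Aff.pr l X) fun i => Aff.x X (Fin.cast h (Fin.castAdd m i)))
    fun i => Aff.x X (Fin.cast h (Fin.natAdd n i)), ?_, ?_⟩
  · apply Aff.hom_ext
    · apply Aff.hom_ext
      · simp
      · intro i
        simp only [Category.assoc, Aff.lift_pr, appTop_comp_apply, Aff.lift_x, append_left,
          Category.id_comp]
    · intro i
      simp only [appTop_comp_apply, Aff.lift_x, append_right]
      simp
  · apply Aff.hom_ext
    · rw [Category.assoc, Aff.lift_pr, Aff.lift_pr_assoc, Aff.lift_pr, Category.id_comp]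
    · rw [forall_fin h]
      constructor <;> intro i
      · simp only [appTop_comp_apply, Aff.lift_x, append_left]
        rw [← appTop_comp_apply, Aff.lift_pr]
        simp
      · simp only [appTop_comp_apply, Aff.lift_x, append_right]
        simp

lemma etale_compMap {n m l : ℕ} (h : n + m = l) {X Y U V : Scheme.{u}} (p : U ⟶ Aff n X)
    (g : U ⟶ Y) (q : V ⟶ Aff m Y) [Etale p] [Etale q] : Etale (compMap h p g q) := by
  let q₁ : pullback g (q ≫ Aff.pr m Y) ⟶ Aff m U := Aff.lift (pullback.fst _ _)
    (fun j => (pullback.snd g (q ≫ Aff.pr m Y) ≫ q).appTop (Aff.x Y j))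
  have hmap {S T : Scheme.{u}} (f : S ⟶ T) (i) :
    (AffineSpace.map (ULift.{u} (Fin m)) f).appTop (Aff.x T i) = Aff.x S i :=
    AffineSpace.map_appTop_coord f _
  have e₁ : IsPullback (pullback.snd g (q ≫ Aff.pr m Y)) q₁ q (AffineSpace.map _ g) := by
    refine IsPullback.of_bot (v₂₁ := Aff.pr m U) (v₂₂ := Aff.pr m Y) (h₃₁ := g) ?_ ?_
      (AffineSpace.isPullback_map g)
    · rw [Aff.lift_pr]; exact (IsPullback.of_hasPullback _ _).flip
    · apply Aff.hom_ext
      · rw [Category.assoc, Category.assoc, AffineSpace.map_over, Aff.lift_pr_assoc]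
        exact pullback.condition.symm
      · intro i
        rw [appTop_comp_apply _ (AffineSpace.map _ g), hmap, Aff.lift_x]
  have : Etale q₁ := MorphismProperty.of_isPullback e₁ ‹_›
  have : Etale (AffineSpace.map (ULift.{u} (Fin m)) p) :=
    MorphismProperty.of_isPullback (AffineSpace.isPullback_map p).flip ‹_›
  have := isIso_lift_append h X
  have key : compMap h p g q = q₁ ≫ AffineSpace.map _ p ≫
      Aff.lift (Aff.pr m (Aff n X) ≫ Aff.pr n X)
      (append h (fun i => (Aff.pr m (Aff n X)).appTop (Aff.x X i))
        (fun j => Aff.x (Aff n X) j)) := by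
    have h1 : q₁ ≫ AffineSpace.map _ p ≫ Aff.pr m (Aff n X) = pullback.fst _ _ ≫ p := by
      rw [AffineSpace.map_over, Aff.lift_pr_assoc]
    apply Aff.hom_ext
    · simp only [Category.assoc, Aff.lift_pr, compMap]
      rw [reassoc_of% h1]
    · rw [forall_fin h]
      constructor <;> intro i
      · rw [← Category.assoc, appTop_comp_apply _ (Aff.lift _ _), Aff.lift_x, compMap, Aff.lift_x,
          append_left, append_left, ← appTop_comp_apply, Category.assoc, h1]
      · rw [← Category.assoc, appTop_comp_apply _ (Aff.lift _ _), Aff.lift_x, compMap, Aff.lift_x,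
          append_right, append_right, appTop_comp_apply q₁, hmap, Aff.lift_x]
  rw [key]
  infer_instance

/-- An explicit framed correspondence of level `n` from `X` to `Y` (schemes over `B`): a closed
subset `Z` of `𝔸ⁿ × X` finite over `X`, an étale neighbourhood `p : W ⟶ 𝔸ⁿ × X` of `Z`, functions
`φ 0, …, φ (n - 1)` on `W` whose common vanishing locus is `Z`, and a morphism `g : W ⟶ Y`. -/
structure Corr {B : Scheme.{u}} (n : ℕ) (X Y : Over B) where
  /-- The étale neighbourhood. -/
  W : Scheme.{u}
  /-- The étale morphism from the neighbourhood. -/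
  p : W ⟶ Aff n X.left
  /-- The support. -/
  Z : Closeds (Aff n X.left)
  /-- The framing functions. -/
  φ : Fin n → Γ(W, ⊤)
  /-- The morphism to the target. -/
  g : W ⟶ Y.left
  /-- `g` is a morphism over `B`. -/
  g_over : g ≫ Y.hom = p ≫ Aff.pr n X.left ≫ X.hom
  /-- The support is finite over `X`. -/
  finite : IsFinite (redι Z ≫ Aff.pr n X.left)
  /-- `p` is étale. -/
  etale : Etale p
  /-- `p` is an isomorphism over the support: `p⁻¹(Z) ≅ Z`. -/
  iso : IsIso (pullback.snd p (redι Z))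
  /-- The vanishing locus of the framing functions is (the preimage of) the support. -/
  vanish : ∀ w : W, p w ∈ Z ↔ Vanishes φ w

attribute [instance] Corr.finite Corr.etale Corr.iso

namespace Corr

variable {B : Scheme.{u}} {n m l : ℕ} {X Y T : Over B}

/-- The section of the étale neighbourhood over the support. -/
noncomputable def s (a : Corr n X Y) :
    (Scheme.IdealSheafData.vanishingIdeal a.Z).subscheme ⟶ a.W :=
  inv (pullback.snd a.p (redι a.Z)) ≫ pullback.fst a.p (redι a.Z)

lemma isPullback_s (a : Corr n X Y) : IsPullback a.s (𝟙 _) a.p (redι a.Z) := by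
  have h := IsPullback.of_hasPullback a.p (redι a.Z)
  exact h.of_iso (asIso (pullback.snd a.p (redι a.Z))) (Iso.refl _) (Iso.refl _) (Iso.refl _)
    (by simp [s]) (by simp) (by simp) (by simp)

lemma range_s (a : Corr n X Y) : Set.range a.s = {w | Vanishes a.φ w} := by
  ext w
  rw [Set.mem_ofPred_eq, ← a.vanish]
  constructor
  · rintro ⟨z, rfl⟩
    rw [← Scheme.Hom.comp_apply, a.isPullback_s.w, Category.id_comp]
    exact (range_redι a.Z).subset ⟨z, rfl⟩
  · intro hw
    obtain ⟨z, hz⟩ := (range_redι a.Z).superset hw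
    obtain ⟨z, hz, -⟩ := Scheme.exists_preimage_of_isPullback a.isPullback_s w z hz.symm
    exact ⟨z, hz⟩

lemma injOn (a : Corr n X Y) {w w' : a.W} (hw : Vanishes a.φ w) (hw' : Vanishes a.φ w')
    (h : a.p w = a.p w') : w = w' := by
  have h1 : w ∈ Set.range a.s := a.range_s.superset hw
  have h2 : w' ∈ Set.range a.s := a.range_s.superset hw'
  obtain ⟨z, rfl⟩ := h1
  obtain ⟨z', rfl⟩ := h2
  rw [← Scheme.Hom.comp_apply, ← Scheme.Hom.comp_apply, a.isPullback_s.w, Category.id_comp] at h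
  rw [(redι a.Z).isEmbedding.injective h]

lemma mem_Z (a : Corr n X Y) (z : Aff n X.left) :
    z ∈ a.Z ↔ ∃ w, Vanishes a.φ w ∧ a.p w = z := by
  constructor
  · intro hz
    obtain ⟨y, rfl⟩ := (range_redι a.Z).superset hz
    refine ⟨a.s y, a.range_s.subset ⟨y, rfl⟩, ?_⟩
    rw [← Scheme.Hom.comp_apply, a.isPullback_s.w, Category.id_comp]
  · rintro ⟨w, hw, rfl⟩
    exact (a.vanish w).mpr hw

/-- A constructor for framed correspondences: `W` is étale over `𝔸ⁿ × X` via `p`, and the common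
vanishing locus of the `φ i` is the image of `q : P ⟶ W`, where `P` is finite over `X`, embedded
into `𝔸ⁿ × X` and equal to its own preimage in `W`. The support is the image of `P`. -/
noncomputable def ofSection {W P : Scheme.{u}} (p : W ⟶ Aff n X.left) (φ : Fin n → Γ(W, ⊤))
    (g : W ⟶ Y.left) (q : P ⟶ W) (hg : g ≫ Y.hom = p ≫ Aff.pr n X.left ≫ X.hom)
    (hp : Etale p) (hfin : IsFinite ((q ≫ p) ≫ Aff.pr n X.left)) (hmono : Mono (q ≫ p))
    (hq : IsPullback q (𝟙 P) p (q ≫ p))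
    (hφ : ∀ w, w ∈ Set.range q ↔ Vanishes φ w) : Corr n X Y where
  W := W
  p := p
  Z := ⟨Set.range (q ≫ p), by
    have := isClosedImmersion_of_isFinite_comp (q ≫ p) (Aff.pr n X.left)
    exact (q ≫ p).isClosedEmbedding.isClosed_range⟩
  φ := φ
  g := g
  g_over := hg
  finite := (nbhd_criterion p (q ≫ p) q (Aff.pr n X.left) hq _ rfl).1
  etale := hp
  iso := (nbhd_criterion p (q ≫ p) q (Aff.pr n X.left) hq _ rfl).2.1
  vanish w := by
    rw [(nbhd_criterion p (q ≫ p) q (Aff.pr n X.left) hq _ rfl).2.2, hφ]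

lemma isPullback_of_unique {W P A : Scheme.{u}} (q : P ⟶ W) (p : W ⟶ A)
    (H : ∀ {S : Scheme.{u}} (w : S ⟶ W) (c : S ⟶ P), w ≫ p = c ≫ q ≫ p → w = c ≫ q) :
    IsPullback q (𝟙 P) p (q ≫ p) :=
  ⟨⟨by simp⟩, ⟨PullbackCone.IsLimit.mk _ (fun s => s.snd)
    (fun s => (H s.fst s.snd s.condition).symm) (fun s => by simp)
    (fun s m _ h => by simpa using h)⟩⟩

instance mono_s (a : Corr n X Y) : Mono a.s := by
  have : Mono (a.s ≫ a.p) := by rw [a.isPullback_s.w, Category.id_comp]; infer_instance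
  exact mono_of_mono a.s a.p

lemma compMap_cancel (h : n + m = l) {X Y U V S : Scheme.{u}} (p : U ⟶ Aff n X)
    (g : U ⟶ Y) (q : V ⟶ Aff m Y) (w w' : S ⟶ pullback g (q ≫ Aff.pr m Y))
    (H : w ≫ compMap h p g q = w' ≫ compMap h p g q) :
    w ≫ pullback.fst _ _ ≫ p = w' ≫ pullback.fst _ _ ≫ p ∧
    ∀ j, (w ≫ pullback.snd _ _ ≫ q).appTop (Aff.x Y j) =
      (w' ≫ pullback.snd _ _ ≫ q).appTop (Aff.x Y j) := by
  have hx (i) : (w ≫ compMap h p g q).appTop (Aff.x X i) =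
    (w' ≫ compMap h p g q).appTop (Aff.x X i) := by rw [H]
  rw [forall_fin h] at hx
  refine ⟨Aff.hom_ext ?_ fun i => ?_, fun i => ?_⟩
  · have := congr($H ≫ Aff.pr l X)
    simpa only [Category.assoc, compMap, Aff.lift_pr] using this
  · have := hx.1 i
    rw [appTop_comp_apply w, appTop_comp_apply w', compMap, Aff.lift_x, append_left] at this
    rw [appTop_comp_apply w, appTop_comp_apply w', this]
  · have := hx.2 i
    rw [appTop_comp_apply w, appTop_comp_apply w', compMap, Aff.lift_x, append_right] at this
    rw [appTop_comp_apply w, appTop_comp_apply w', this]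

/-- The inclusion of the support of a composite in its étale neighbourhood. -/
noncomputable def compSection (a : Corr n X Y) (b : Corr m Y T) :
    pullback (a.s ≫ a.g) (redι b.Z ≫ Aff.pr m Y.left) ⟶
      pullback a.g (b.p ≫ Aff.pr m Y.left) :=
  pullback.map _ _ _ _ a.s b.s (𝟙 _) (by simp) (by
    rw [Category.comp_id, reassoc_of% b.isPullback_s.w])

lemma compSection_fst (a : Corr n X Y) (b : Corr m Y T) :
    compSection a b ≫ pullback.fst _ _ = pullback.fst _ _ ≫ a.s := pullback.lift_fst _ _ _

lemma compSection_snd (a : Corr n X Y) (b : Corr m Y T) :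
    compSection a b ≫ pullback.snd _ _ = pullback.snd _ _ ≫ b.s := pullback.lift_snd _ _ _

lemma isPullback_compSection (h : n + m = l) (a : Corr n X Y) (b : Corr m Y T) :
    IsPullback (compSection a b) (𝟙 _) (compMap h a.p a.g b.p)
      (compSection a b ≫ compMap h a.p a.g b.p) := by
  apply isPullback_of_unique
  intro S w c H
  rw [← Category.assoc] at H
  obtain ⟨h1, h2⟩ := compMap_cancel h a.p a.g b.p w (c ≫ compSection a b) H
  have f1 : (c ≫ compSection a b) ≫ pullback.fst _ _ = (c ≫ pullback.fst _ _) ≫ a.s := by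
    rw [Category.assoc, compSection_fst, Category.assoc]
  have f2 : (c ≫ compSection a b) ≫ pullback.snd _ _ = (c ≫ pullback.snd _ _) ≫ b.s := by
    rw [Category.assoc, compSection_snd, Category.assoc]
  have e1 : w ≫ pullback.fst _ _ = (c ≫ compSection a b) ≫ pullback.fst _ _ := by
    rw [f1]
    have hw : (w ≫ pullback.fst _ _) ≫ a.p = (c ≫ pullback.fst _ _) ≫ redι a.Z := by
      rw [Category.assoc, h1, ← Category.assoc, f1, Category.assoc, a.isPullback_s.w,
        Category.id_comp]
    have := a.isPullback_s.lift_fst _ _ hw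
    have h' := a.isPullback_s.lift_snd _ _ hw
    rw [Category.comp_id] at h'
    rw [← this, h']
  apply pullback.hom_ext e1
  rw [f2]
  have hw : (w ≫ pullback.snd _ _) ≫ b.p = (c ≫ pullback.snd _ _) ≫ redι b.Z := by
    have f3 : (c ≫ pullback.snd _ _) ≫ redι b.Z =
        (c ≫ compSection a b) ≫ pullback.snd _ _ ≫ b.p := by
      rw [← Category.assoc (c ≫ _), f2, Category.assoc (c ≫ _), b.isPullback_s.w,
        Category.id_comp]
    rw [f3]
    apply Aff.hom_ext
    · simp only [Category.assoc] at e1 ⊢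
      rw [← pullback.condition, reassoc_of% e1]
    · intro i
      rw [Category.assoc, h2 i]
  have := b.isPullback_s.lift_fst _ _ hw
  have h' := b.isPullback_s.lift_snd _ _ hw
  rw [Category.comp_id] at h'
  rw [← this, h']

/-- The composition of explicit framed correspondences, in diagrammatic order: the composite of
`(U, φ, g)` from `X` to `Y` and `(V, ψ, f)` from `Y` to `T` is
`(U ×_Y V, (φ ∘ pr_U, ψ ∘ pr_V), f ∘ pr_V)`, with support the image in `𝔸ⁿ⁺ᵐ × X` of
`Z ×_Y Z'`. The level `l` of the composite is `n + m`. -/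
noncomputable def comp (h : n + m = l) (a : Corr n X Y) (b : Corr m Y T) : Corr l X T :=
  ofSection (compMap h a.p a.g b.p)
    (append h (fun i => (pullback.fst a.g (b.p ≫ Aff.pr m Y.left)).appTop (a.φ i))
      (fun j => (pullback.snd a.g (b.p ≫ Aff.pr m Y.left)).appTop (b.φ j)))
    (pullback.snd _ _ ≫ b.g) (compSection a b)
    (by
      rw [Category.assoc, b.g_over, compMap, Aff.lift_pr_assoc, Category.assoc, Category.assoc,
        ← a.g_over, pullback.condition_assoc, Category.assoc])
    (etale_compMap h _ _ _)
    (by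
      have : (compSection a b ≫ compMap h a.p a.g b.p) ≫ Aff.pr l X.left =
          pullback.fst (a.s ≫ a.g) (redι b.Z ≫ Aff.pr m Y.left) ≫ redι a.Z ≫ Aff.pr n X.left := by
        rw [Category.assoc, compMap, Aff.lift_pr]
        simp only [compSection, pullback.map, pullback.lift_fst_assoc, Category.assoc]
        rw [reassoc_of% a.isPullback_s.w]
      rw [this]
      infer_instance)
    (by
      constructor
      intro S c c' H
      simp only [← Category.assoc] at H
      have h1 := (isPullback_compSection h a b).lift_fst (c' ≫ compSection a b) c
        (by rw [← H, Category.assoc])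
      have h2 := (isPullback_compSection h a b).lift_snd (c' ≫ compSection a b) c
        (by rw [← H, Category.assoc])
      rw [Category.comp_id] at h2
      rw [h2] at h1
      apply pullback.hom_ext
      · rw [← cancel_mono a.s]
        have := congr($h1 ≫ pullback.fst _ _)
        simpa only [Category.assoc, compSection_fst] using this
      · rw [← cancel_mono b.s]
        have := congr($h1 ≫ pullback.snd _ _)
        simpa only [Category.assoc, compSection_snd] using this)
    (isPullback_compSection h a b)
    (by
      intro w
      rw [vanishes_append, vanishes_pullback, vanishes_pullback, compSection,
        Scheme.Pullback.range_map, a.range_s, b.range_s]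
      rfl)

/-- The first projection of the étale neighbourhood of a composite. -/
noncomputable def fst (h : n + m = l) (a : Corr n X Y) (b : Corr m Y T) : (comp h a b).W ⟶ a.W :=
  pullback.fst a.g (b.p ≫ Aff.pr m Y.left)

/-- The second projection of the étale neighbourhood of a composite. -/
noncomputable def snd (h : n + m = l) (a : Corr n X Y) (b : Corr m Y T) : (comp h a b).W ⟶ b.W :=
  pullback.snd a.g (b.p ≫ Aff.pr m Y.left)

lemma isPullback_comp (h : n + m = l) (a : Corr n X Y) (b : Corr m Y T) :
    IsPullback (fst h a b) (snd h a b) a.g (b.p ≫ Aff.pr m Y.left) :=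
  IsPullback.of_hasPullback _ _

lemma comp_p_pr (h : n + m = l) (a : Corr n X Y) (b : Corr m Y T) :
    (comp h a b).p ≫ Aff.pr l X.left = fst h a b ≫ a.p ≫ Aff.pr n X.left :=
  Aff.lift_pr _ _

lemma comp_p_left (h : n + m = l) (a : Corr n X Y) (b : Corr m Y T) (i : Fin n) :
    (comp h a b).p.appTop (Aff.x X.left (Fin.cast h (Fin.castAdd m i))) =
      (fst h a b).appTop (a.p.appTop (Aff.x X.left i)) := by
  rw [← appTop_comp_apply]
  exact (Aff.lift_x _ _ _).trans (append_left _ _ _ _)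

lemma comp_p_right (h : n + m = l) (a : Corr n X Y) (b : Corr m Y T) (i : Fin m) :
    (comp h a b).p.appTop (Aff.x X.left (Fin.cast h (Fin.natAdd n i))) =
      (snd h a b).appTop (b.p.appTop (Aff.x Y.left i)) := by
  rw [← appTop_comp_apply]
  exact (Aff.lift_x _ _ _).trans (append_right _ _ _ _)

lemma comp_φ_left (h : n + m = l) (a : Corr n X Y) (b : Corr m Y T) (i : Fin n) :
    (comp h a b).φ (Fin.cast h (Fin.castAdd m i)) = (fst h a b).appTop (a.φ i) :=
  append_left h (fun i => (pullback.fst a.g (b.p ≫ Aff.pr m Y.left)).appTop (a.φ i))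
    (fun j => (pullback.snd a.g (b.p ≫ Aff.pr m Y.left)).appTop (b.φ j)) i

lemma comp_φ_right (h : n + m = l) (a : Corr n X Y) (b : Corr m Y T) (i : Fin m) :
    (comp h a b).φ (Fin.cast h (Fin.natAdd n i)) = (snd h a b).appTop (b.φ i) :=
  append_right h (fun i => (pullback.fst a.g (b.p ≫ Aff.pr m Y.left)).appTop (a.φ i))
    (fun j => (pullback.snd a.g (b.p ≫ Aff.pr m Y.left)).appTop (b.φ j)) i

lemma comp_g (h : n + m = l) (a : Corr n X Y) (b : Corr m Y T) :
    (comp h a b).g = snd h a b ≫ b.g := rfl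

/-- A criterion for a morphism to the étale neighbourhood of a composite to lie over the
affine space. -/
lemma comp_p_ext (h : n + m = l) (a : Corr n X Y) (b : Corr m Y T) {S : Scheme.{u}}
    (e : S ⟶ (comp h a b).W) (q : S ⟶ Aff l X.left)
    (h₁ : e ≫ fst h a b ≫ a.p ≫ Aff.pr n X.left = q ≫ Aff.pr l X.left)
    (h₂ : ∀ i, (e ≫ fst h a b).appTop (a.p.appTop (Aff.x X.left i)) =
      q.appTop (Aff.x X.left (Fin.cast h (Fin.castAdd m i))))
    (h₃ : ∀ i, (e ≫ snd h a b).appTop (b.p.appTop (Aff.x Y.left i)) =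
      q.appTop (Aff.x X.left (Fin.cast h (Fin.natAdd n i)))) :
    e ≫ (comp h a b).p = q := by
  apply Aff.hom_ext
  · rw [Category.assoc, comp_p_pr, h₁]
  · rw [forall_fin h]
    constructor <;> intro i
    · rw [appTop_comp_apply, comp_p_left, ← h₂, appTop_comp_apply e]
    · rw [appTop_comp_apply, comp_p_right, ← h₃, appTop_comp_apply e]

lemma comp_φ_ext (h : n + m = l) (a : Corr n X Y) (b : Corr m Y T) {S : Scheme.{u}}
    (e : S ⟶ (comp h a b).W) (φ : Fin l → Γ(S, ⊤))
    (h₂ : ∀ i, (e ≫ fst h a b).appTop (a.φ i) = φ (Fin.cast h (Fin.castAdd m i)))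
    (h₃ : ∀ i, (e ≫ snd h a b).appTop (b.φ i) = φ (Fin.cast h (Fin.natAdd n i))) :
    ∀ i, e.appTop ((comp h a b).φ i) = φ i := by
  rw [forall_fin h]
  constructor <;> intro i
  · rw [comp_φ_left, ← h₂, appTop_comp_apply e]
  · rw [comp_φ_right, ← h₃, appTop_comp_apply e]

/-- The framed correspondence `(X, X; f)` of level zero given by a morphism `f : X ⟶ Y`. -/
noncomputable def ofHom (f : X ⟶ Y) : Corr 0 X Y :=
  ofSection (W := X.left) (P := X.left) (Aff.lift (𝟙 _) (fun i => i.elim0)) (fun i => i.elim0)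
    f.left (𝟙 _) (by simp)
    (by
      have : IsIso (Aff.lift (𝟙 X.left) (fun i : Fin 0 => i.elim0)) :=
        ⟨Aff.pr 0 _, by simp, Aff.hom_ext (by simp) (fun i => i.elim0)⟩
      infer_instance)
    (by simp; infer_instance)
    (by
      have : Mono ((𝟙 X.left ≫ Aff.lift (𝟙 X.left) (fun i : Fin 0 => i.elim0)) ≫ Aff.pr 0 _) := by
        simp; infer_instance
      exact mono_of_mono _ (Aff.pr 0 X.left))
    (isPullback_of_unique _ _ (by
      intro S w c H
      have := congr($H ≫ Aff.pr 0 X.left)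
      simpa using this))
    (by simp [Vanishes])

lemma range_zero (X : Scheme.{u}) (w : Aff 1 X) :
    w ∈ Set.range (Aff.lift (n := 1) (𝟙 X) (fun _ => 0)) ↔ Vanishes (Aff.x (n := 1) X) w := by
  constructor
  · rintro ⟨y, rfl⟩
    rw [← vanishes_pullback]
    intro i
    simp
  · intro hw
    let r := (Aff 1 X).fromSpecResidueField w
    have : r = (r ≫ Aff.pr 1 X) ≫ Aff.lift (n := 1) (𝟙 X) (fun _ => 0) := by
      apply Aff.hom_ext
      · rw [Category.assoc, Aff.lift_pr]; simp
      · intro i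
        rw [appTop_comp_apply _ (Aff.lift _ _), Aff.lift_x, map_zero,
          ← AlgebraicGeometry.basicOpen_eq_bot_iff, eq_bot_iff]
        intro y hy
        refine absurd hy ((notMem_basicOpen_appTop _ _ _).mpr ?_)
        rw [Scheme.fromSpecResidueField_apply]
        exact hw i
    have hmem : w ∈ Set.range r := by
      rw [Scheme.range_fromSpecResidueField]; rfl
    obtain ⟨y, hy⟩ := hmem
    rw [this] at hy
    exact ⟨_, hy⟩

/-- The framed correspondence `σ_X = (X × 0, X × 𝔸¹, t; pr_X)` of level one. -/
noncomputable def sigma (X : Over B) : Corr 1 X X :=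
  ofSection (W := Aff 1 X.left) (P := X.left) (𝟙 _) (Aff.x X.left) (Aff.pr 1 X.left)
    (Aff.lift (𝟙 _) (fun _ => 0)) (by simp) inferInstance
    (by simp; infer_instance)
    (by
      have : Mono ((Aff.lift (𝟙 X.left) (fun _ : Fin 1 => 0) ≫ 𝟙 _) ≫ Aff.pr 1 _) := by
        simp; infer_instance
      exact mono_of_mono _ (Aff.pr 1 X.left))
    (isPullback_of_unique _ _ (by
      intro S w c H
      simpa using H))
    (range_zero _)

/-- A morphism of étale neighbourhoods `a'.W ⟶ a.W` over `𝔸ⁿ × X` along which the functions and the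
morphism to `Y` of `a` restrict to those of `a'` (nothing is said about the supports; the support
of `a'` is then contained in that of `a`). -/
structure Restriction (a' a : Corr n X Y) where
  /-- The morphism of étale neighbourhoods. -/
  e : a'.W ⟶ a.W
  e_p : e ≫ a.p = a'.p
  e_φ : ∀ i, e.appTop (a.φ i) = a'.φ i
  e_g : e ≫ a.g = a'.g

/-- Equivalence of explicit framed correspondences: the supports coincide, and on some common étale
neighbourhood of the support (namely `c.W`) the functions agree and the morphisms to `Y` agree. -/
def Equivalent (a b : Corr n X Y) : Prop :=
  ∃ c : Corr n X Y, c.Z = a.Z ∧ c.Z = b.Z ∧ Nonempty (Restriction c a) ∧ Nonempty (Restriction c b)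

lemma Restriction.vanishes {a' a : Corr n X Y} (r : Restriction a' a) (w : a'.W) :
    Vanishes a'.φ w ↔ Vanishes a.φ (r.e w) := by
  rw [← vanishes_pullback]
  simp only [r.e_φ]

lemma equivalent_of_iso {a b : Corr n X Y} (r : Restriction a b) [IsIso r.e] :
    Equivalent a b := by
  refine ⟨a, rfl, ?_, ⟨⟨𝟙 _, by simp, by simp, by simp⟩⟩, ⟨r⟩⟩
  ext z
  change z ∈ a.Z ↔ z ∈ b.Z
  rw [mem_Z, mem_Z]
  constructor
  · rintro ⟨w, hw, rfl⟩
    exact ⟨r.e w, (r.vanishes w).mp hw, by rw [← Scheme.Hom.comp_apply, r.e_p]⟩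
  · rintro ⟨w, hw, rfl⟩
    have hinv : r.e (inv r.e w) = w := by rw [← Scheme.Hom.comp_apply]; simp
    refine ⟨inv r.e w, ?_, ?_⟩
    · rw [r.vanishes, hinv]; exact hw
    · rw [← r.e_p, Scheme.Hom.comp_apply, hinv]

/-- Restriction of étale neighbourhoods is compatible with composition. -/
noncomputable def Restriction.comp (h : n + m = l) {a' a : Corr n X Y} {b' b : Corr m Y T}
    (r : Restriction a' a) (t : Restriction b' b) :
    Restriction (Corr.comp h a' b') (Corr.comp h a b) :=
  have hw : (fst h a' b' ≫ r.e) ≫ a.g = (snd h a' b' ≫ t.e) ≫ b.p ≫ Aff.pr m Y.left := by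
    rw [Category.assoc, r.e_g, (isPullback_comp h a' b').w, Category.assoc, reassoc_of% t.e_p]
  have h1 := (isPullback_comp h a b).lift_fst _ _ hw
  have h2 := (isPullback_comp h a b).lift_snd _ _ hw
  { e := (isPullback_comp h a b).lift _ _ hw
    e_p := by
      apply comp_p_ext
      · rw [← Category.assoc, h1, Category.assoc, reassoc_of% r.e_p, comp_p_pr]
      · intro i
        rw [h1, comp_p_left, appTop_comp_apply, ← appTop_comp_apply r.e, r.e_p]
      · intro i
        rw [h2, comp_p_right, appTop_comp_apply, ← appTop_comp_apply t.e, t.e_p]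
    e_φ := by
      apply comp_φ_ext
      · intro i
        rw [h1, comp_φ_left, appTop_comp_apply, r.e_φ]
      · intro i
        rw [h2, comp_φ_right, appTop_comp_apply, t.e_φ]
    e_g := by rw [comp_g, comp_g, ← Category.assoc, h2, Category.assoc, t.e_g] }

lemma Restriction.comp_fst (h : n + m = l) {a' a : Corr n X Y} {b' b : Corr m Y T}
    (r : Restriction a' a) (t : Restriction b' b) :
    (r.comp h t).e ≫ fst h a b = fst h a' b' ≫ r.e :=
  (isPullback_comp h a b).lift_fst _ _ _

lemma Restriction.comp_snd (h : n + m = l) {a' a : Corr n X Y} {b' b : Corr m Y T}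
    (r : Restriction a' a) (t : Restriction b' b) :
    (r.comp h t).e ≫ snd h a b = snd h a' b' ≫ t.e :=
  (isPullback_comp h a b).lift_snd _ _ _

lemma Restriction.range_comp (h : n + m = l) {a' a : Corr n X Y} {b' b : Corr m Y T}
    (r : Restriction a' a) (t : Restriction b' b) :
    Set.range (r.comp h t).e = fst h a b ⁻¹' Set.range r.e ∩ snd h a b ⁻¹' Set.range t.e := by
  have hr : a'.g ≫ 𝟙 _ = r.e ≫ a.g := by rw [r.e_g, Category.comp_id]
  have ht : (b'.p ≫ Aff.pr m Y.left) ≫ 𝟙 _ = t.e ≫ b.p ≫ Aff.pr m Y.left := by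
    rw [reassoc_of% t.e_p, Category.comp_id]
  have he : (r.comp h t).e = pullback.map _ _ _ _ r.e t.e (𝟙 _) hr ht := by
    apply (isPullback_comp h a b).hom_ext
    · rw [comp_fst]; exact (pullback.lift_fst _ _ _).symm
    · rw [comp_snd]; exact (pullback.lift_snd _ _ _).symm
  rw [he]
  exact Scheme.Pullback.range_map _ _ _ _ r.e t.e (𝟙 _) hr ht

lemma comp_vanishes (h : n + m = l) (a : Corr n X Y) (b : Corr m Y T) (w : (comp h a b).W) :
    Vanishes (comp h a b).φ w ↔
      Vanishes a.φ (fst h a b w) ∧ Vanishes b.φ (snd h a b w) := by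
  rw [← vanishes_pullback, ← vanishes_pullback]
  simp only [Vanishes, forall_fin h, comp_φ_left, comp_φ_right]

/-- The support of a composite after restricting the étale neighbourhoods. -/
lemma mem_comp_Z (h : n + m = l) {a' a : Corr n X Y} {b' b : Corr m Y T}
    (r : Restriction a' a) (t : Restriction b' b) (z : Aff l X.left) :
    z ∈ (comp h a' b').Z ↔ ∃ w : (comp h a b).W, Vanishes (comp h a b).φ w ∧
      (comp h a b).p w = z ∧
      a.p (fst h a b w) ∈ a'.Z ∧
      b.p (snd h a b w) ∈ b'.Z := by
  rw [mem_Z]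
  let rt := r.comp h t
  have hfst (w : (comp h a' b').W) : fst h a b (rt.e w) = r.e (fst h a' b' w) := by
    rw [← Scheme.Hom.comp_apply, ← Scheme.Hom.comp_apply, r.comp_fst h t]
  have hsnd (w : (comp h a' b').W) : snd h a b (rt.e w) = t.e (snd h a' b' w) := by
    rw [← Scheme.Hom.comp_apply, ← Scheme.Hom.comp_apply, r.comp_snd h t]
  constructor
  · rintro ⟨w, hw, rfl⟩
    refine ⟨rt.e w, (rt.vanishes w).mp hw, ?_, ?_, ?_⟩
    · rw [← Scheme.Hom.comp_apply, rt.e_p]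
    · rw [hfst, ← Scheme.Hom.comp_apply, r.e_p, a'.vanish]
      exact ((comp_vanishes h a' b' w).mp hw).1
    · rw [hsnd, ← Scheme.Hom.comp_apply, t.e_p, b'.vanish]
      exact ((comp_vanishes h a' b' w).mp hw).2
  · rintro ⟨w, hw, rfl, h1, h2⟩
    obtain ⟨hw1, hw2⟩ := (comp_vanishes h a b w).mp hw
    obtain ⟨u, hu, hu'⟩ := (a'.mem_Z _).mp h1
    obtain ⟨v, hv, hv'⟩ := (b'.mem_Z _).mp h2
    have eu : r.e u = fst h a b w :=
      a.injOn ((r.vanishes u).mp hu) hw1 (by rw [← hu', ← r.e_p]; rfl)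
    have ev : t.e v = snd h a b w :=
      b.injOn ((t.vanishes v).mp hv) hw2 (by rw [← hv', ← t.e_p]; rfl)
    obtain ⟨x, hx⟩ := (r.range_comp h t).superset
      (show w ∈ fst h a b ⁻¹' Set.range r.e ∩ snd h a b ⁻¹' Set.range t.e from ⟨⟨u, eu⟩, ⟨v, ev⟩⟩)
    have hx : rt.e x = w := hx
    refine ⟨x, ?_, ?_⟩
    · rw [rt.vanishes, hx]; exact hw
    · rw [← rt.e_p, Scheme.Hom.comp_apply, hx]

lemma comp_Z_eq (h : n + m = l) {a' a : Corr n X Y} {b' b : Corr m Y T}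
    (r : Restriction a' a) (t : Restriction b' b) (ha : a'.Z = a.Z) (hb : b'.Z = b.Z) :
    (comp h a' b').Z = (comp h a b).Z := by
  ext z
  change z ∈ (comp h a' b').Z ↔ z ∈ (comp h a b).Z
  rw [mem_comp_Z h r t, mem_Z, ha, hb]
  constructor
  · rintro ⟨w, hw, hz, -⟩
    exact ⟨w, hw, hz⟩
  · rintro ⟨w, hw, hz⟩
    obtain ⟨h1, h2⟩ := (comp_vanishes h a b w).mp hw
    exact ⟨w, hw, hz, (a.vanish _).mpr h1, (b.vanish _).mpr h2⟩

lemma Equivalent.refl (a : Corr n X Y) : Equivalent a a :=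
  ⟨a, rfl, rfl, ⟨⟨𝟙 _, by simp, by simp, by simp⟩⟩, ⟨⟨𝟙 _, by simp, by simp, by simp⟩⟩⟩

lemma Equivalent.comp (h : n + m = l) {a₁ a₂ : Corr n X Y} {b₁ b₂ : Corr m Y T}
    (ha : Equivalent a₁ a₂) (hb : Equivalent b₁ b₂) :
    Equivalent (Corr.comp h a₁ b₁) (Corr.comp h a₂ b₂) := by
  obtain ⟨a, ha1, ha2, ⟨r1⟩, ⟨r2⟩⟩ := ha
  obtain ⟨b, hb1, hb2, ⟨t1⟩, ⟨t2⟩⟩ := hb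
  exact ⟨Corr.comp h a b, comp_Z_eq h r1 t1 ha1 hb1, comp_Z_eq h r2 t2 ha2 hb2,
    ⟨r1.comp h t1⟩, ⟨r2.comp h t2⟩⟩

/-- The support of `a` is the disjoint union of two closed subsets `Z₁`, `Z₂`, and `a₁`, `a₂` are
the restrictions `(W - Z₂, φ, g)` and `(W - Z₁, φ, g)` of `a` with supports `Z₁` and `Z₂` (up to
equivalence: a morphism of étale neighbourhoods `a₁.W ⟶ a.W` as in `Restriction` automatically has
image in `W - Z₂`, so that `a₁` is equivalent to the restriction of `a` to `W - Z₂`). -/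
def IsDecomposition (a a₁ a₂ : Corr n X Y) : Prop :=
  (a.Z : Set (Aff n X.left)) = (a₁.Z : Set (Aff n X.left)) ∪ a₂.Z ∧ Disjoint (a₁.Z : Set (Aff n X.left)) a₂.Z ∧
    Nonempty (Restriction a₁ a) ∧ Nonempty (Restriction a₂ a)

lemma IsDecomposition.comp_left (h : n + m = l) {a a₁ a₂ : Corr n X Y}
    (H : IsDecomposition a a₁ a₂) (b : Corr m Y T) :
    IsDecomposition (comp h a b) (comp h a₁ b) (comp h a₂ b) := by
  obtain ⟨h1, h2, ⟨r1⟩, ⟨r2⟩⟩ := H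
  let t : Restriction b b := ⟨𝟙 _, by simp, by simp, by simp⟩
  have hdis (x) (hx : x ∈ a₁.Z) (hx' : x ∈ a₂.Z) : False := Set.disjoint_left.mp h2 hx hx'
  have hun (x) (hx : x ∈ a.Z) : x ∈ a₁.Z ∨ x ∈ a₂.Z := h1.subset hx
  refine ⟨?_, ?_, ⟨r1.comp h t⟩, ⟨r2.comp h t⟩⟩
  · ext z
    change z ∈ (comp h a b).Z ↔ z ∈ (comp h a₁ b).Z ∨ z ∈ (comp h a₂ b).Z
    rw [mem_comp_Z h r1 t, mem_comp_Z h r2 t, mem_Z]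
    constructor
    · rintro ⟨w, hw, hz⟩
      obtain ⟨h1, h2⟩ := (comp_vanishes h a b w).mp hw
      rcases hun _ ((a.vanish _).mpr h1) with hu | hu
      · exact Or.inl ⟨w, hw, hz, hu, (b.vanish _).mpr h2⟩
      · exact Or.inr ⟨w, hw, hz, hu, (b.vanish _).mpr h2⟩
    · rintro (⟨w, hw, hz, -⟩ | ⟨w, hw, hz, -⟩) <;> exact ⟨w, hw, hz⟩
  · rw [Set.disjoint_left]
    intro z hz hz'
    obtain ⟨w, hw, hwz, hu, -⟩ := (mem_comp_Z h r1 t z).mp hz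
    obtain ⟨w', hw', hwz', hu', -⟩ := (mem_comp_Z h r2 t z).mp hz'
    obtain rfl := (comp h a b).injOn hw hw' (hwz.trans hwz'.symm)
    exact hdis _ hu hu'

lemma IsDecomposition.comp_right (h : n + m = l) (a : Corr n X Y) {b b₁ b₂ : Corr m Y T}
    (H : IsDecomposition b b₁ b₂) :
    IsDecomposition (comp h a b) (comp h a b₁) (comp h a b₂) := by
  obtain ⟨h1, h2, ⟨r1⟩, ⟨r2⟩⟩ := H
  let t : Restriction a a := ⟨𝟙 _, by simp, by simp, by simp⟩
  have hdis (x) (hx : x ∈ b₁.Z) (hx' : x ∈ b₂.Z) : False := Set.disjoint_left.mp h2 hx hx'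
  have hun (x) (hx : x ∈ b.Z) : x ∈ b₁.Z ∨ x ∈ b₂.Z := h1.subset hx
  refine ⟨?_, ?_, ⟨t.comp h r1⟩, ⟨t.comp h r2⟩⟩
  · ext z
    change z ∈ (comp h a b).Z ↔ z ∈ (comp h a b₁).Z ∨ z ∈ (comp h a b₂).Z
    rw [mem_comp_Z h t r1, mem_comp_Z h t r2, mem_Z]
    constructor
    · rintro ⟨w, hw, hz⟩
      obtain ⟨h1, h2⟩ := (comp_vanishes h a b w).mp hw
      rcases hun _ ((b.vanish _).mpr h2) with hu | hu
      · exact Or.inl ⟨w, hw, hz, (a.vanish _).mpr h1, hu⟩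
      · exact Or.inr ⟨w, hw, hz, (a.vanish _).mpr h1, hu⟩
    · rintro (⟨w, hw, hz, -⟩ | ⟨w, hw, hz, -⟩) <;> exact ⟨w, hw, hz⟩
  · rw [Set.disjoint_left]
    intro z hz hz'
    obtain ⟨w, hw, hwz, -, hu⟩ := (mem_comp_Z h t r1 z).mp hz
    obtain ⟨w', hw', hwz', -, hu'⟩ := (mem_comp_Z h t r2 z).mp hz'
    obtain rfl := (comp h a b).injOn hw hw' (hwz.trans hwz'.symm)
    exact hdis _ hu hu'

variable {S : Over B}

/-- Composition of framed correspondences is associative up to equivalence. -/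
lemma comp_assoc_equivalent {r l₁ l₂ t : ℕ} (h₁ : n + m = l₁) (h₂ : l₁ + r = t)
    (h₃ : m + r = l₂) (h₄ : n + l₂ = t) (a : Corr n X Y) (b : Corr m Y T) (c : Corr r T S) :
    Equivalent (comp h₂ (comp h₁ a b) c) (comp h₄ a (comp h₃ b c)) := by
  have pab := isPullback_comp h₁ a b
  have pbc := isPullback_comp h₃ b c
  have pL := isPullback_comp h₂ (comp h₁ a b) c
  have pR := isPullback_comp h₄ a (comp h₃ b c)
  rw [comp_g] at pL
  rw [comp_p_pr] at pR
  have w1 : (fst h₂ (comp h₁ a b) c ≫ snd h₁ a b) ≫ b.g =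
      snd h₂ (comp h₁ a b) c ≫ c.p ≫ Aff.pr r T.left := by
    rw [Category.assoc, pL.w]
  have w2 : (fst h₂ (comp h₁ a b) c ≫ fst h₁ a b) ≫ a.g =
      pbc.lift _ _ w1 ≫ fst h₃ b c ≫ b.p ≫ Aff.pr m Y.left := by
    rw [Category.assoc, pab.w, pbc.lift_fst_assoc, Category.assoc]
  have w3 : fst h₄ a (comp h₃ b c) ≫ a.g =
      (snd h₄ a (comp h₃ b c) ≫ fst h₃ b c) ≫ b.p ≫ Aff.pr m Y.left := by
    rw [pR.w, Category.assoc]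
  have w4 : pab.lift _ _ w3 ≫ snd h₁ a b ≫ b.g =
      (snd h₄ a (comp h₃ b c) ≫ snd h₃ b c) ≫ c.p ≫ Aff.pr r T.left := by
    rw [pab.lift_snd_assoc, Category.assoc, pbc.w, Category.assoc]
  let e := pR.lift _ _ w2
  have e1 : e ≫ fst h₄ a (comp h₃ b c) = fst h₂ (comp h₁ a b) c ≫ fst h₁ a b := pR.lift_fst _ _ w2
  have e2 : e ≫ snd h₄ a (comp h₃ b c) = pbc.lift _ _ w1 := pR.lift_snd _ _ w2
  have e3 : (e ≫ snd h₄ a (comp h₃ b c)) ≫ fst h₃ b c = fst h₂ (comp h₁ a b) c ≫ snd h₁ a b := by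
    rw [e2, pbc.lift_fst]
  have e4 : (e ≫ snd h₄ a (comp h₃ b c)) ≫ snd h₃ b c = snd h₂ (comp h₁ a b) c := by
    rw [e2, pbc.lift_snd]
  have he : IsIso e := by
    refine ⟨pL.lift _ _ w4, ?_, ?_⟩
    · apply pL.hom_ext
      · rw [Category.assoc, pL.lift_fst, Category.id_comp]
        apply pab.hom_ext
        · rw [Category.assoc, pab.lift_fst, e1]
        · rw [Category.assoc, pab.lift_snd, ← Category.assoc, e3]
      · rw [Category.assoc, pL.lift_snd, Category.id_comp, ← Category.assoc, e4]
    · apply pR.hom_ext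
      · rw [Category.assoc, e1, pL.lift_fst_assoc, pab.lift_fst, Category.id_comp]
      · rw [Category.assoc, e2, Category.id_comp]
        apply pbc.hom_ext
        · rw [Category.assoc, pbc.lift_fst, pL.lift_fst_assoc, pab.lift_snd]
        · rw [Category.assoc, pbc.lift_snd, pL.lift_snd]
  let R : Restriction (comp h₂ (comp h₁ a b) c) (comp h₄ a (comp h₃ b c)) :=
    { e := e
      e_p := by
        apply comp_p_ext
        · rw [← Category.assoc, e1, comp_p_pr, comp_p_pr, Category.assoc]
        · intro i
          rw [e1]
          have : (Fin.cast h₄ (Fin.castAdd l₂ i)) =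
            Fin.cast h₂ (Fin.castAdd r (Fin.cast h₁ (Fin.castAdd m i))) := by ext; simp
          rw [this, comp_p_left, comp_p_left, appTop_comp_apply]
        · rw [forall_fin h₃]
          constructor <;> intro i
          · rw [comp_p_left, ← appTop_comp_apply _ (fst h₃ b c), e3]
            have : (Fin.cast h₄ (Fin.natAdd n (Fin.cast h₃ (Fin.castAdd r i)))) =
              Fin.cast h₂ (Fin.castAdd r (Fin.cast h₁ (Fin.natAdd n i))) := by ext; simp
            rw [this, comp_p_left, comp_p_right, appTop_comp_apply]
          · rw [comp_p_right, ← appTop_comp_apply _ (snd h₃ b c), e4]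
            have : (Fin.cast h₄ (Fin.natAdd n (Fin.cast h₃ (Fin.natAdd m i)))) =
              Fin.cast h₂ (Fin.natAdd l₁ i) := by ext; simp; omega
            rw [this, comp_p_right]
      e_φ := by
        apply comp_φ_ext
        · intro i
          rw [e1]
          have : (Fin.cast h₄ (Fin.castAdd l₂ i)) =
            Fin.cast h₂ (Fin.castAdd r (Fin.cast h₁ (Fin.castAdd m i))) := by ext; simp
          rw [this, comp_φ_left, comp_φ_left, appTop_comp_apply]
        · rw [forall_fin h₃]
          constructor <;> intro i
          · rw [comp_φ_left, ← appTop_comp_apply _ (fst h₃ b c), e3]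
            have : (Fin.cast h₄ (Fin.natAdd n (Fin.cast h₃ (Fin.castAdd r i)))) =
              Fin.cast h₂ (Fin.castAdd r (Fin.cast h₁ (Fin.natAdd n i))) := by ext; simp
            rw [this, comp_φ_left, comp_φ_right, appTop_comp_apply]
          · rw [comp_φ_right, ← appTop_comp_apply _ (snd h₃ b c), e4]
            have : (Fin.cast h₄ (Fin.natAdd n (Fin.cast h₃ (Fin.natAdd m i)))) =
              Fin.cast h₂ (Fin.natAdd l₁ i) := by ext; simp; omega
            rw [this, comp_φ_right]
      e_g := by
        rw [comp_g, comp_g, comp_g, ← Category.assoc, ← Category.assoc, e4] }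
  have : IsIso R.e := he
  exact equivalent_of_iso R

/-- Recognizing a composite. -/
lemma equivalent_comp_of_isPullback (h : n + m = l) (c : Corr l X T) (a : Corr n X Y)
    (b : Corr m Y T) (u : c.W ⟶ a.W) (v : c.W ⟶ b.W)
    (H : IsPullback u v a.g (b.p ≫ Aff.pr m Y.left))
    (h₁ : u ≫ a.p ≫ Aff.pr n X.left = c.p ≫ Aff.pr l X.left)
    (h₂ : ∀ i, u.appTop (a.p.appTop (Aff.x X.left i)) =
      c.p.appTop (Aff.x X.left (Fin.cast h (Fin.castAdd m i))))
    (h₃ : ∀ i, v.appTop (b.p.appTop (Aff.x Y.left i)) =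
      c.p.appTop (Aff.x X.left (Fin.cast h (Fin.natAdd n i))))
    (h₄ : ∀ i, u.appTop (a.φ i) = c.φ (Fin.cast h (Fin.castAdd m i)))
    (h₅ : ∀ i, v.appTop (b.φ i) = c.φ (Fin.cast h (Fin.natAdd n i)))
    (h₆ : v ≫ b.g = c.g) : Equivalent c (comp h a b) := by
  let e := H.isoIsPullback _ _ (isPullback_comp h a b)
  have e1 : e.hom ≫ fst h a b = u := H.isoIsPullback_hom_fst _ _ _
  have e2 : e.hom ≫ snd h a b = v := H.isoIsPullback_hom_snd _ _ _
  let R : Restriction c (comp h a b) :=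
    { e := e.hom
      e_p := comp_p_ext h a b e.hom c.p (by rw [← Category.assoc, e1, h₁])
        (fun i => by rw [e1, h₂]) (fun i => by rw [e2, h₃])
      e_φ := comp_φ_ext h a b e.hom c.φ (fun i => by rw [e1, h₄]) (fun i => by rw [e2, h₅])
      e_g := by rw [comp_g, ← Category.assoc, e2, h₆] }
  have : IsIso R.e := inferInstanceAs (IsIso e.hom)
  exact equivalent_of_iso R

lemma ofHom_p_pr (f : X ⟶ Y) : (ofHom f).p ≫ Aff.pr 0 X.left = 𝟙 X.left := Aff.lift_pr _ _

lemma ofHom_comp_equivalent (f : X ⟶ Y) (g : Y ⟶ T) :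
    Equivalent (ofHom (f ≫ g)) (comp (Nat.zero_add 0) (ofHom f) (ofHom g)) := by
  refine equivalent_comp_of_isPullback _ (ofHom (f ≫ g)) (ofHom f) (ofHom g) (𝟙 X.left) f.left
    ?_ ?_ (fun i => i.elim0) (fun i => i.elim0) (fun i => i.elim0) (fun i => i.elim0) rfl
  · rw [ofHom_p_pr]
    change IsPullback (𝟙 X.left) f.left f.left (𝟙 Y.left)
    exact IsPullback.of_horiz_isIso ⟨by simp⟩
  · rw [ofHom_p_pr, ofHom_p_pr]
    exact Category.id_comp (𝟙 X.left)

/-- The correspondences `σ` are compatible with morphisms. -/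
lemma sigma_comp_equivalent (f : X ⟶ Y) : ∃ c,
    Equivalent c (comp (Nat.add_zero 1) (sigma X) (ofHom f)) ∧
    Equivalent c (comp (Nat.zero_add 1) (ofHom f) (sigma Y)) := by
  let c : Corr 1 X Y :=
    { sigma X with
      g := Aff.pr 1 X.left ≫ f.left
      g_over := by
        change (Aff.pr 1 X.left ≫ f.left) ≫ Y.hom = 𝟙 (Aff 1 X.left) ≫ Aff.pr 1 X.left ≫ X.hom
        simp }
  have hid (s : Γ(Aff 1 X.left, ⊤)) : (𝟙 (Aff 1 X.left) : _ ⟶ _).appTop s = s := by simp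
  have hid' (s : Γ(Aff 1 Y.left, ⊤)) : (𝟙 (Aff 1 Y.left) : _ ⟶ _).appTop s = s := by simp
  have hmap (i) : (AffineSpace.map (ULift.{u} (Fin 1)) f.left).appTop (Aff.x Y.left i) =
    Aff.x X.left i := AffineSpace.map_appTop_coord f.left _
  refine ⟨c, ?_, ?_⟩
  · refine equivalent_comp_of_isPullback _ c (sigma X) (ofHom f) (𝟙 (Aff 1 X.left))
      (Aff.pr 1 X.left) ?_ ?_ (fun i => ?_) (fun i => i.elim0) (fun i => ?_) (fun i => i.elim0) rfl
    · rw [ofHom_p_pr]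
      change IsPullback (𝟙 (Aff 1 X.left)) (Aff.pr 1 X.left) (Aff.pr 1 X.left) (𝟙 X.left)
      exact IsPullback.of_horiz_isIso ⟨by simp⟩
    · exact Category.id_comp (𝟙 (Aff 1 X.left) ≫ Aff.pr 1 X.left)
    · exact hid _
    · exact hid _
  · refine equivalent_comp_of_isPullback _ c (ofHom f) (sigma Y) (Aff.pr 1 X.left)
      (AffineSpace.map _ f.left) ?_ ?_ (fun i => i.elim0) (fun i => ?_) (fun i => i.elim0)
      (fun i => ?_) ?_
    · change IsPullback (Aff.pr 1 X.left) (AffineSpace.map _ f.left) f.left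
        (𝟙 (Aff 1 Y.left) ≫ Aff.pr 1 Y.left)
      rw [Category.id_comp]
      exact (AffineSpace.isPullback_map f.left).flip
    · rw [ofHom_p_pr]
      change Aff.pr 1 X.left ≫ 𝟙 X.left = 𝟙 (Aff 1 X.left) ≫ Aff.pr 1 X.left
      rw [Category.comp_id, Category.id_comp]
    · have hi : Fin.cast (Nat.zero_add 1) (Fin.natAdd 0 i) = i := Subsingleton.elim _ _
      rw [hi]
      exact (congrArg (AffineSpace.map (ULift.{u} (Fin 1)) f.left).appTop (hid' _)).trans
        ((hmap i).trans (hid _).symm)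
    · have hi : Fin.cast (Nat.zero_add 1) (Fin.natAdd 0 i) = i := Subsingleton.elim _ _
      rw [hi]
      exact hmap i
    · exact AffineSpace.map_over f.left

end Corr
variable {B : Scheme.{u}} {n m l : ℕ} {X Y T S : Over B}

/-- The set `Fr_n(X, Y)` of framed correspondences of level `n`: explicit framed correspondences
modulo equivalence (`Equivalent` is an equivalence relation, since étale neighbourhoods have common
refinements). -/
def Fr {B : Scheme.{u}} (n : ℕ) (X Y : Over B) : Type (u + 1) :=
  Quot (Corr.Equivalent (n := n) (X := X) (Y := Y))

/-- The class of an explicit framed correspondence in `Fr_n(X, Y)`. -/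
def Fr.mk (a : Corr n X Y) : Fr n X Y := Quot.mk _ a

/-- The composition `Fr_n(X, Y) × Fr_m(Y, T) → Fr_{n+m}(X, T)` (in diagrammatic order). -/
noncomputable def Fr.comp (h : n + m = l) : Fr n X Y → Fr m Y T → Fr l X T :=
  Quot.map₂ (Corr.comp h) (fun a _ _ hb => (Corr.Equivalent.refl a).comp h hb)
    (fun _ _ b ha => ha.comp h (Corr.Equivalent.refl b))

/-- The subgroup `⟨Z₁ ⊔ Z₂ - Z₁ - Z₂⟩` of `ℤFr_n(X, Y)`. -/
def additivity {B : Scheme.{u}} (n : ℕ) (X Y : Over B) :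
    AddSubgroup (FreeAbelianGroup (Fr n X Y)) :=
  AddSubgroup.closure {x | ∃ a a₁ a₂ : Corr n X Y, a.IsDecomposition a₁ a₂ ∧
    x = FreeAbelianGroup.of (Fr.mk a) - FreeAbelianGroup.of (Fr.mk a₁) -
      FreeAbelianGroup.of (Fr.mk a₂)}

/-- The group `ℤF_n(X, Y) = ℤFr_n(X, Y) / ⟨Z₁ ⊔ Z₂ - Z₁ - Z₂⟩`. -/
abbrev ZF {B : Scheme.{u}} (n : ℕ) (X Y : Over B) : Type (u + 1) :=
  FreeAbelianGroup (Fr n X Y) ⧸ additivity n X Y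

/-- The class `⟨a⟩` of a framed correspondence `a` in `ℤF_n(X, Y)`. -/
noncomputable def ZF.of (a : Corr n X Y) : ZF n X Y :=
  QuotientAddGroup.mk (FreeAbelianGroup.of (Fr.mk a))

lemma ZF.of_eq {a b : Corr n X Y} (h : a.Equivalent b) : ZF.of a = ZF.of b := by
  rw [ZF.of, ZF.of, show Fr.mk a = Fr.mk b from Quot.sound h]

lemma ZF.of_add {a a₁ a₂ : Corr n X Y} (h : a.IsDecomposition a₁ a₂) :
    ZF.of a = ZF.of a₁ + ZF.of a₂ := by
  have : (FreeAbelianGroup.of (Fr.mk a) - FreeAbelianGroup.of (Fr.mk a₁) -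
      FreeAbelianGroup.of (Fr.mk a₂)) ∈ additivity n X Y :=
    AddSubgroup.subset_closure ⟨a, a₁, a₂, h, rfl⟩
  rw [← QuotientAddGroup.eq_zero_iff] at this
  have h2 : ZF.of a - ZF.of a₁ - ZF.of a₂ = 0 := this
  rwa [sub_sub, sub_eq_zero] at h2

lemma ZF.induction {P : ZF n X Y → Prop} (x : ZF n X Y) (h0 : P 0) (hof : ∀ a, P (ZF.of a))
    (hneg : ∀ x, P x → P (-x)) (hadd : ∀ x y, P x → P y → P (x + y)) : P x := by
  induction x using QuotientAddGroup.induction_on with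
  | H z =>
    induction z using FreeAbelianGroup.induction_on with
    | zero => exact h0
    | of a => induction a using Quot.ind with | mk a => exact hof a
    | neg a ih => exact hneg _ ih
    | add a b iha ihb => exact hadd _ _ iha ihb

/-- Postcomposition, for a fixed framed correspondence on the left. -/
noncomputable def ZF.compAux (h : n + m = l) (a : Fr n X Y) : ZF m Y T →+ ZF l X T :=
  QuotientAddGroup.lift _ (FreeAbelianGroup.lift fun b =>
    (QuotientAddGroup.mk (FreeAbelianGroup.of (Fr.comp h a b)) : ZF l X T)) (by
      rw [additivity, AddSubgroup.closure_le]
      rintro _ ⟨b, b₁, b₂, hb, rfl⟩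
      induction a using Quot.ind with
      | mk a =>
        change FreeAbelianGroup.lift _ _ = 0
        rw [map_sub, map_sub, FreeAbelianGroup.lift_apply_of, FreeAbelianGroup.lift_apply_of,
          FreeAbelianGroup.lift_apply_of, sub_sub, sub_eq_zero]
        exact ZF.of_add (hb.comp_right h a))

/-- The composition `ℤF_n(X, Y) × ℤF_m(Y, T) → ℤF_{n+m}(X, T)` (in diagrammatic order),
which extends the composition of framed correspondences bilinearly. -/
noncomputable def ZF.comp (h : n + m = l) : ZF n X Y →+ ZF m Y T →+ ZF l X T :=
  QuotientAddGroup.lift _ (FreeAbelianGroup.lift fun a => ZF.compAux h a) (by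
    rw [additivity, AddSubgroup.closure_le]
    rintro _ ⟨a, a₁, a₂, ha, rfl⟩
    change FreeAbelianGroup.lift _ _ = 0
    rw [map_sub, map_sub, FreeAbelianGroup.lift_apply_of, FreeAbelianGroup.lift_apply_of,
      FreeAbelianGroup.lift_apply_of, sub_sub, sub_eq_zero]
    ext b
    induction b using Quot.ind with
    | mk b =>
      exact ZF.of_add (ha.comp_left h b))

lemma ZF.comp_of (h : n + m = l) (a : Corr n X Y) (b : Corr m Y T) :
    ZF.comp h (ZF.of a) (ZF.of b) = ZF.of (a.comp h b) := by
  simp only [ZF.comp, ZF.of, QuotientAddGroup.lift_mk, FreeAbelianGroup.lift_apply_of, ZF.compAux]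
  rfl

lemma ZF.comp_assoc {r l₁ l₂ t : ℕ} (h₁ : n + m = l₁) (h₂ : l₁ + r = t)
    (h₃ : m + r = l₂) (h₄ : n + l₂ = t) (x : ZF n X Y) (y : ZF m Y T) (z : ZF r T S) :
    ZF.comp h₂ (ZF.comp h₁ x y) z = ZF.comp h₄ x (ZF.comp h₃ y z) := by
  induction x using ZF.induction with
  | h0 => simp
  | hneg x hx => simp [hx]
  | hadd x x' hx hx' => simp [hx, hx']
  | hof a =>
    induction y using ZF.induction with
    | h0 => simp
    | hneg x hx => simp [hx]
    | hadd x x' hx hx' => simp [hx, hx']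
    | hof b =>
      induction z using ZF.induction with
      | h0 => simp
      | hneg x hx => simp [hx]
      | hadd x x' hx hx' => simp [hx, hx']
      | hof c =>
        simp only [ZF.comp_of]
        exact ZF.of_eq (Corr.comp_assoc_equivalent h₁ h₂ h₃ h₄ a b c)

/-- The class of a morphism in `ℤF_0(X, Y)`. -/
noncomputable def ZF.ofHom (f : X ⟶ Y) : ZF 0 X Y := ZF.of (Corr.ofHom f)

lemma ZF.ofHom_comp (f : X ⟶ Y) (g : Y ⟶ T) :
    ZF.ofHom (f ≫ g) = ZF.comp (Nat.zero_add 0) (ZF.ofHom f) (ZF.ofHom g) := by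
  rw [ZF.ofHom, ZF.ofHom, ZF.ofHom, ZF.comp_of, ZF.of_eq (Corr.ofHom_comp_equivalent f g)]

/-- The class of `σ_X` in `ℤF_1(X, X)`. -/
noncomputable def ZF.sigma (X : Over B) : ZF 1 X X := ZF.of (Corr.sigma X)

lemma ZF.sigma_comp (f : X ⟶ Y) :
    ZF.comp (Nat.zero_add 1) (ZF.ofHom f) (ZF.sigma Y) =
      ZF.comp (Nat.add_zero 1) (ZF.sigma X) (ZF.ofHom f) := by
  obtain ⟨c, h1, h2⟩ := Corr.sigma_comp_equivalent f
  rw [ZF.ofHom, ZF.sigma, ZF.sigma, ZF.comp_of, ZF.comp_of, ← ZF.of_eq h1, ← ZF.of_eq h2]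

/-- A pair `(X, V)` of a scheme over `B` and an open subset (an object of `SmOp/k` if `B = Spec k` and
`X` is in `Sm/k`; the groups of morphisms below make sense for all pairs). -/
structure Pair (B : Scheme.{u}) where
  /-- The ambient scheme. -/
  X : Over B
  /-- The open subset. -/
  V : X.left.Opens

namespace Pair

/-- The open subset of a pair as a scheme over `B`. -/
noncomputable abbrev sub (P : Pair B) : Over B := Over.mk (P.V.ι ≫ P.X.hom)

/-- The open embedding of a pair. -/
noncomputable abbrev incl (P : Pair B) : P.sub ⟶ P.X := Over.homMk P.V.ι

/-- The pair `(X, X)`. -/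
abbrev diag (X : Over B) : Pair B := ⟨X, ⊤⟩

/-- The pair `𝔸¹ × (X, V) = (𝔸¹ × X, 𝔸¹ × V)`. -/
noncomputable abbrev A1 (P : Pair B) : Pair B :=
  ⟨Over.mk (Aff.pr 1 P.X.left ≫ P.X.hom), Aff.pr 1 P.X.left ⁻¹ᵁ P.V⟩

/-- Morphisms of pairs. -/
structure Hom (P Q : Pair B) where
  /-- The morphism of ambient schemes. -/
  f : P.X ⟶ Q.X
  /-- It maps the first open subset to the second one. -/
  le : P.V ≤ f.left ⁻¹ᵁ Q.V

/-- The restriction of a morphism of pairs to the open subsets. -/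
noncomputable abbrev Hom.res {P Q : Pair B} (f : Hom P Q) : P.sub ⟶ Q.sub :=
  Over.homMk (f.f.left.resLE Q.V P.V f.le) (by simp)

/-- The section `X ⟶ 𝔸¹ × X` with constant coordinate `c`, as a morphism of pairs. -/
noncomputable def constSection (P : Pair B) (c : Γ(P.X.left, ⊤)) : Hom P P.A1 where
  f := Over.homMk (Aff.lift (𝟙 _) fun _ => c) (by simp)
  le := by
    change P.V ≤ (Aff.lift (n := 1) (𝟙 _) fun _ => c) ⁻¹ᵁ Aff.pr 1 P.X.left ⁻¹ᵁ P.V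
    rw [← Scheme.Hom.comp_preimage, Aff.lift_pr]
    exact le_rfl

end Pair

variable {P Q R : Pair B}

/-- The degree `n` part of the morphisms of pairs: for `P = (Y, W)` and `Q = (X, V)` this is the
kernel of `i_Y^* - i_{X,*} : ℤF_n(Y, X) ⊕ ℤF_n(W, V) → ℤF_n(W, X)`. -/
noncomputable def ZFpr (n : ℕ) (P Q : Pair B) : AddSubgroup (ZF n P.X Q.X × ZF n P.sub Q.sub) :=
  AddMonoidHom.ker
    ((ZF.comp (Nat.zero_add n) (ZF.ofHom P.incl)).comp (AddMonoidHom.fst _ _) -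
      ((ZF.comp (Nat.add_zero n)).flip (ZF.ofHom Q.incl)).comp (AddMonoidHom.snd _ _))

lemma mem_ZFpr (r : ZF n P.X Q.X × ZF n P.sub Q.sub) : r ∈ ZFpr n P Q ↔
    ZF.comp (Nat.zero_add n) (ZF.ofHom P.incl) r.1 =
      ZF.comp (Nat.add_zero n) r.2 (ZF.ofHom Q.incl) := by
  simp [ZFpr, AddMonoidHom.mem_ker, sub_eq_zero]

/-- The composition of morphisms of pairs (componentwise, in diagrammatic order). -/
noncomputable def ZFpr.comp (h : n + m = l) : ZFpr n P Q →+ ZFpr m Q R →+ ZFpr l P R :=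
  AddMonoidHom.mk' (fun a => AddMonoidHom.mk' (fun b =>
    ⟨(ZF.comp h a.1.1 b.1.1, ZF.comp h a.1.2 b.1.2), by
      have ha := (mem_ZFpr _).mp a.2
      have hb := (mem_ZFpr _).mp b.2
      rw [mem_ZFpr]
      change ZF.comp _ (ZF.ofHom P.incl) (ZF.comp h a.1.1 b.1.1) =
        ZF.comp _ (ZF.comp h a.1.2 b.1.2) (ZF.ofHom R.incl)
      rw [← ZF.comp_assoc (Nat.zero_add n) h, ha, ZF.comp_assoc (Nat.add_zero n) h
        (Nat.zero_add m) h, hb, ZF.comp_assoc h (Nat.add_zero l) (Nat.add_zero m) h]⟩)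
    (fun b b' => by ext <;> simp)) (fun a a' => by ext <;> simp)

/-- The morphism of level zero given by a morphism of pairs. -/
noncomputable def ZFpr.ofHom (f : Pair.Hom P Q) : ZFpr 0 P Q :=
  ⟨(ZF.ofHom f.f, ZF.ofHom f.res), by
    rw [mem_ZFpr]
    change ZF.comp _ (ZF.ofHom P.incl) (ZF.ofHom f.f) = ZF.comp _ (ZF.ofHom f.res) (ZF.ofHom Q.incl)
    rw [← ZF.ofHom_comp, ← ZF.ofHom_comp]
    congr 1
    ext1
    simp⟩

/-- The morphism `⟨⟨σ_X⟩⟩ = (σ_X, σ_V)` of the pair `(X, V)`. -/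
noncomputable def ZFpr.sigma (P : Pair B) : ZFpr 1 P P :=
  ⟨(ZF.sigma P.X, ZF.sigma P.sub), by
    rw [mem_ZFpr]
    exact ZF.sigma_comp _⟩

/-- The map `i_0^* - i_1^*` on morphisms of pairs, where `i_0, i_1 : P ⟶ 𝔸¹ × P` are the zero and
unit sections. -/
noncomputable def homotopyMap (n : ℕ) (P Q : Pair B) : ZFpr n P.A1 Q →+ ZFpr n P Q :=
  ZFpr.comp (Nat.zero_add n) (ZFpr.ofHom (P.constSection 0)) -
    ZFpr.comp (Nat.zero_add n) (ZFpr.ofHom (P.constSection 1))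

/-- The morphisms of pairs up to homotopy: the cokernel of
`i_0^* - i_1^* : ℤF^pr_n(𝔸¹ × P, Q) → ℤF^pr_n(P, Q)`. -/
abbrev ZFbarpr (n : ℕ) (P Q : Pair B) : Type (u + 1) :=
  ZFpr n P Q ⧸ (homotopyMap n P Q).range

/-- `X` is an object of `Sm/k`: smooth, separated and of finite type (a smooth morphism is locally
of finite type). -/
structure IsSmoothVariety (X : Over B) : Prop where
  smooth : Smooth X.hom
  separated : IsSeparated X.hom
  quasiCompact : QuasiCompact X.hom

/-- The degree `n` part of the two-sided ideal generated by the identity morphisms of the pairs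
`(X, X)`, `X` in `Sm/k`, in the category with morphisms `ZFbarpr`. Since the identities have degree
zero, it is generated by the composites `P ⟶ (X, X) ⟶ Q` of total degree `n`. -/
noncomputable def idIdeal (n : ℕ) (P Q : Pair B) : AddSubgroup (ZFbarpr n P Q) :=
  AddSubgroup.closure {x | ∃ (p q : ℕ) (h : p + q = n) (X : Over B) (_ : IsSmoothVariety X)
    (a : ZFpr p P (Pair.diag X)) (b : ZFpr q (Pair.diag X) Q),
    x = QuotientAddGroup.mk (ZFpr.comp h a b)}

/-- The degree `n` morphisms `P ⟶ Q` modulo homotopy and the identities of all pairs `(X, X)`. -/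
abbrev ZFbarbar (n : ℕ) (P Q : Pair B) : Type (u + 1) :=
  ZFbarpr n P Q ⧸ idIdeal n P Q

/-- The class of a morphism of pairs modulo homotopy and the identities of all pairs `(X, X)`.
The composite of two classes is the class of the composite. -/
noncomputable def cls (r : ZFpr n P Q) : ZFbarbar n P Q :=
  QuotientAddGroup.mk (QuotientAddGroup.mk r : ZFbarpr n P Q)

/-- The affine line over a field `k`. -/
noncomputable abbrev affineLine (k : Type u) [Field k] : Scheme.{u} := Aff 1 (Spec (.of k))

/-- For open subsets `U`, `W` of the affine line, the pair `(U, U ∩ W)` over `k`. -/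
noncomputable abbrev openPair {k : Type u} [Field k] (U W : (affineLine k).Opens) :
    Pair (Spec (.of k)) :=
  ⟨Over.mk (U.ι ≫ Aff.pr 1 (Spec (.of k))), U.ι ⁻¹ᵁ W⟩

/-- The inclusion of pairs `(V, V ∩ W') ⟶ (U, U ∩ W)` for `V ⊆ U` and `W' ⊆ W`. -/
noncomputable def openPair.incl {k : Type u} [Field k] {V U W' W : (affineLine k).Opens}
    (h : V ≤ U) (h' : W' ≤ W) : Pair.Hom (openPair V W') (openPair U W) where
  f := Over.homMk ((affineLine k).homOfLE h) (by simp)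
  le := by
    change V.ι ⁻¹ᵁ W' ≤ (affineLine k).homOfLE h ⁻¹ᵁ U.ι ⁻¹ᵁ W
    rw [← Scheme.Hom.comp_preimage, Scheme.homOfLE_ι]
    exact V.ι.preimage_mono h'

end FramedCorr

open FramedCorr

namespace FramedCorr

/-! Every open subset of the affine line over `k` is the non-vanishing locus of a polynomial, so the
geometry turns into congruences. Let `a ∣ b` be monic with U = {a ≠ 0} and V = {b ≠ 0}, and let `s`
be monic, prime to `b`, with U - S and V - S equal to {s ≠ 0} inside U and V. Write `y` for the
coordinate of U and `X` for the variable of the framing. By the Chinese remainder theorem there is a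
monic f of large degree over the functions on U with f ≡ 1 mod `b` and f ≡ X - y mod `s`. The
framing f together with the map `X` to the line is a correspondence that serves both as `r` and as
`l`. The roots of f avoid the zeros of `b`, hence lie in V. Over U - S, where s(y) is invertible,
they avoid the zeros of `s` as well, hence lie in V - S.

Composing with the inclusion only enlarges the target to U or restricts the source to V; f and its
congruences persist. Both identities therefore follow from one statement about a single pair,
`cls_pairCorr_eq_sigma`: such an f has the class of σ. Three moves prove it. (1) Monic polynomials
of a fixed degree with prescribed residues form an affine space, so a linear homotopy deforms f to F
= (X - y)h with h ≡ 1 mod s(X - y) and F ≡ 1 mod a. (2) The factors of F are coprime, so additivity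
splits the correspondence. The roots of h avoid the zeros of `a` and of `s`, so the part supported
there factors through (U - S, U - S) and dies. (3) What remains is supported on the graph X = y with
framing (X - y)h; moving the graph to X = 0 while deforming h to 1 gives σ.

The polynomials needed come from `exists_monic_congr` and `exists_monic_congr_one_X`;
`exists_eq_mul_isCoprime` produces `s`. -/

/-! ### Polynomial functions on the affine line over a scheme. -/

/-- The function on `𝔸¹ × X` given by a polynomial over the ring of functions on `X`. -/
noncomputable def polyFn (X : Scheme.{u}) : Polynomial Γ(X, ⊤) →+* Γ(Aff 1 X, ⊤) :=
  Polynomial.eval₂RingHom (Aff.pr 1 X).appTop.hom (Aff.x X 0)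

lemma polyFn_C (X : Scheme.{u}) (r : Γ(X, ⊤)) :
    polyFn X (Polynomial.C r) = (Aff.pr 1 X).appTop r := by
  simp [polyFn]

@[simp]
lemma polyFn_X (X : Scheme.{u}) : polyFn X Polynomial.X = Aff.x X 0 := by
  simp [polyFn]

/-- The action on functions of a morphism to `𝔸¹ × X`. -/
lemma appTop_polyFn {X T : Scheme.{u}} (f : T ⟶ Aff 1 X) (p : Polynomial Γ(X, ⊤)) :
    f.appTop (polyFn X p) =
      Polynomial.eval₂ (f ≫ Aff.pr 1 X).appTop.hom (f.appTop (Aff.x X 0)) p := by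
  rw [polyFn, Polynomial.coe_eval₂RingHom]
  refine (Polynomial.hom_eval₂ p _ f.appTop.hom _).trans ?_
  rw [Scheme.Hom.comp_appTop]
  rfl

lemma map_appTop_polyFn {X Y : Scheme.{u}} (f : X ⟶ Y) (p : Polynomial Γ(Y, ⊤)) :
    (AffineSpace.map (ULift.{u} (Fin 1)) f).appTop (polyFn Y p) =
      polyFn X (p.map f.appTop.hom) := by
  rw [appTop_polyFn, AffineSpace.map_over, polyFn, Polynomial.coe_eval₂RingHom,
    Polynomial.eval₂_map, Scheme.Hom.comp_appTop]
  congr 1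
  exact AffineSpace.map_appTop_coord f _

/-- The morphism from the affine line over `X` to the spectrum of the polynomial ring over the ring
of functions on `X`. -/
noncomputable def toSpecPoly (X : Scheme.{u}) : Aff 1 X ⟶ Spec (.of (Polynomial Γ(X, ⊤))) :=
  (Aff 1 X).toSpecΓ ≫ Spec.map (CommRingCat.ofHom (polyFn X))

lemma toSpecPoly_preimage_basicOpen (X : Scheme.{u}) (p : Polynomial Γ(X, ⊤)) :
    toSpecPoly X ⁻¹ᵁ PrimeSpectrum.basicOpen p = (Aff 1 X).basicOpen (polyFn X p) := by
  exact Scheme.toSpecΓ_preimage_basicOpen (Aff 1 X) (polyFn X p)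

lemma hom_Spec_ext {T : Scheme.{u}} {A : CommRingCat.{u}} {f g : T ⟶ Spec A}
    (h : (Scheme.ΓSpecIso A).inv ≫ f.appTop = (Scheme.ΓSpecIso A).inv ≫ g.appTop) : f = g := by
  apply ext_of_isAffine
  rwa [cancel_epi] at h

lemma appTop_toSpecPoly (X : Scheme.{u}) : (Scheme.ΓSpecIso _).inv ≫ (toSpecPoly X).appTop =
    CommRingCat.ofHom (polyFn X) := by
  simp [toSpecPoly, Scheme.ΓSpecIso_naturality]

/-- A morphism to either corner amounts to a morphism to `X` and one function. No affineness of `X`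
is assumed. Finiteness of supports, smoothness of the projection and the description of opens of the
line over `k` are all reduced to polynomial rings through this square. -/
lemma isPullback_toSpecPoly (X : Scheme.{u}) :
    IsPullback (toSpecPoly X) (Aff.pr 1 X)
      (Spec.map (CommRingCat.ofHom (Polynomial.C : Γ(X, ⊤) →+* _))) X.toSpecΓ := by
  have hw : toSpecPoly X ≫ Spec.map (CommRingCat.ofHom (Polynomial.C : Γ(X, ⊤) →+* _)) =
      Aff.pr 1 X ≫ X.toSpecΓ := by
    rw [Scheme.toSpecΓ_naturality, toSpecPoly, Category.assoc, ← Spec.map_comp,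
      ← CommRingCat.ofHom_comp]
    congr 2
    ext r
    exact polyFn_C X r
  refine ⟨⟨hw⟩, ⟨PullbackCone.IsLimit.mk _ (fun s => Aff.lift s.snd fun _ =>
    s.fst.appTop ((Scheme.ΓSpecIso _).inv Polynomial.X)) ?_ (fun s => Aff.lift_pr _ _) ?_⟩⟩
  · intro s
    apply hom_Spec_ext
    rw [Scheme.Hom.comp_appTop, ← Category.assoc, appTop_toSpecPoly]
    ext : 1
    apply Polynomial.ringHom_ext'
    · have h : CommRingCat.ofHom (Polynomial.C : Γ(X, ⊤) →+* _) ≫ (Scheme.ΓSpecIso _).inv ≫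
          s.fst.appTop = s.snd.appTop := by
        rw [Scheme.ΓSpecIso_inv_naturality_assoc, ← Scheme.Hom.comp_appTop, s.condition,
          Scheme.Hom.comp_appTop, Scheme.toSpecΓ_appTop]
        exact Iso.inv_hom_id_assoc _ _
      ext r
      refine Eq.trans ?_ congr($h.symm r)
      change (Aff.lift _ _).appTop (polyFn X (Polynomial.C r)) = _
      rw [polyFn_C, ← appTop_comp_apply, Aff.lift_pr]
    · change (Aff.lift _ _).appTop (polyFn X Polynomial.X) = _
      rw [polyFn_X, Aff.lift_x]
      rfl
  · intro s m h1 h2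
    apply Aff.hom_ext
    · rw [Aff.lift_pr, h2]
    · intro i
      rw [Aff.lift_x, ← h1, Scheme.Hom.comp_appTop, Subsingleton.elim i 0, ← polyFn_X]
      have := congr($(appTop_toSpecPoly X) Polynomial.X)
      exact congr(m.appTop $this).symm

/-- The vanishing locus of the function given by a polynomial. -/
noncomputable def polyZeros (X : Scheme.{u}) (p : Polynomial Γ(X, ⊤)) : Closeds (Aff 1 X) :=
  ⟨((Aff 1 X).basicOpen (polyFn X p) : Set (Aff 1 X))ᶜ,
    ((Aff 1 X).basicOpen (polyFn X p)).isOpen.isClosed_compl⟩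

lemma mem_polyZeros {X : Scheme.{u}} {p : Polynomial Γ(X, ⊤)} {z : Aff 1 X} :
    z ∈ polyZeros X p ↔ z ∉ (Aff 1 X).basicOpen (polyFn X p) := Iff.rfl

/-- The vanishing locus of a monic polynomial is finite over the base. -/
lemma isFinite_polyZeros {X : Scheme.{u}} {p : Polynomial Γ(X, ⊤)} (hp : p.Monic) :
    IsFinite (redι (polyZeros X p) ≫ Aff.pr 1 X) := by
  let q : CommRingCat.of (Polynomial Γ(X, ⊤)) ⟶ CommRingCat.of (AdjoinRoot p) :=
    CommRingCat.ofHom (AdjoinRoot.mk p)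
  have hq : Function.Surjective q.hom := AdjoinRoot.mk_surjective
  have : IsClosedImmersion (Spec.map q) := IsClosedImmersion.spec_of_surjective q hq
  -- The zero locus with its possibly non-reduced structure, a base change of the spectrum of
  -- `AdjoinRoot p`, is finite over `X` because `p` is monic. `nbhd_criterion` then passes to the
  -- reduced structure.
  let c := pullback.fst (toSpecPoly X) (Spec.map q)
  have h1 : IsPullback (pullback.snd (toSpecPoly X) (Spec.map q)) (c ≫ Aff.pr 1 X)
      (Spec.map q ≫ Spec.map (CommRingCat.ofHom (Polynomial.C : Γ(X, ⊤) →+* _))) X.toSpecΓ :=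
    (IsPullback.of_hasPullback (toSpecPoly X) (Spec.map q)).flip.paste_vert
      (isPullback_toSpecPoly X)
  have h2 : IsFinite (Spec.map q ≫
      Spec.map (CommRingCat.ofHom (Polynomial.C : Γ(X, ⊤) →+* _))) := by
    rw [← Spec.map_comp, IsFinite.SpecMap_iff]
    have := hp.finite_adjoinRoot
    have h3 : (algebraMap Γ(X, ⊤) (AdjoinRoot p)).Finite := RingHom.finite_algebraMap.mpr this
    exact h3
  have : IsFinite (c ≫ Aff.pr 1 X) := MorphismProperty.of_isPullback h1 h2
  refine (nbhd_criterion (𝟙 _) c c (Aff.pr 1 X) (IsPullback.of_vert_isIso ⟨by simp⟩) _ ?_).1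
  have hr : Set.range c = toSpecPoly X ⁻¹' Set.range (Spec.map q) :=
    Scheme.Pullback.range_fst (toSpecPoly X) (Spec.map q)
  have h4 : Set.range (Spec.map q) = PrimeSpectrum.zeroLocus {p} := by
    refine (range_comap_of_surjective _ _ hq).trans ?_
    rw [show RingHom.ker q.hom = Ideal.span {p} from Ideal.mk_ker]
    exact PrimeSpectrum.zeroLocus_span _
  rw [hr, h4]
  ext z
  change z ∉ (Aff 1 X).basicOpen (polyFn X p) ↔ _
  rw [← toSpecPoly_preimage_basicOpen]
  exact (PrimeSpectrum.mem_basicOpen _ _).not_left.trans Set.singleton_subset_iff.symm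

/-! ### Framed correspondences of level one given by polynomials. -/

/-- The affine line over `B` as an object over `B`. -/
noncomputable abbrev line (B : Scheme.{u}) : Over B := Over.mk (Aff.pr 1 B)

variable {B : Scheme.{u}}

/-- The morphism from the affine line over `X` to the affine line over `B` given by a polynomial. -/
noncomputable def toLine (X : Over B) (γ : Polynomial Γ(X.left, ⊤)) : Aff 1 X.left ⟶ Aff 1 B :=
  Aff.lift (Aff.pr 1 X.left ≫ X.hom) fun _ => polyFn X.left γ

lemma map_toLine {X X' : Over B} (f : X' ⟶ X) (γ : Polynomial Γ(X.left, ⊤)) :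
    AffineSpace.map _ f.left ≫ toLine X γ = toLine X' (γ.map f.left.appTop.hom) := by
  apply Aff.hom_ext
  · rw [Category.assoc, toLine, toLine, Aff.lift_pr, Aff.lift_pr, AffineSpace.map_over_assoc,
      Over.w]
  · intro i
    rw [appTop_comp_apply, toLine, toLine, Aff.lift_x, Aff.lift_x, map_appTop_polyFn]

/-- Pulling back along `γ` is substituting `γ`; this turns conditions on the image of the support
into coprimality of polynomials. -/
lemma toLine_appTop_polyFn (X : Over B) (γ : Polynomial Γ(X.left, ⊤)) (p : Polynomial Γ(B, ⊤)) :
    (toLine X γ).appTop (polyFn B p) = polyFn X.left ((p.map X.hom.appTop.hom).comp γ) := by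
  rw [appTop_polyFn, toLine, Aff.lift_pr, Aff.lift_x, Polynomial.comp, Polynomial.eval₂_map,
    Polynomial.hom_eval₂]
  congr 1
  ext r
  simp only [RingHom.comp_apply, polyFn_C]
  exact appTop_comp_apply _ _ _

lemma _root_.IsCoprime.polynomial_map {R S : Type*} [CommRing R] [CommRing S]
    {p q : Polynomial R} (h : IsCoprime p q) (f : R →+* S) : IsCoprime (p.map f) (q.map f) :=
  h.map (Polynomial.mapRingHom f)

/-- Polynomials defining a framed correspondence of level one with values in the affine line: the
support is the vanishing locus of the monic polynomial `m`, the framing is `m * u`, and the morphism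
to the affine line is given by `γ`. -/
@[ext]
structure LineData (X : Scheme.{u}) where
  /-- The equation of the support. -/
  m : Polynomial Γ(X, ⊤)
  /-- The remaining factor of the framing. -/
  u : Polynomial Γ(X, ⊤)
  /-- The coordinate of the morphism to the affine line. -/
  γ : Polynomial Γ(X, ⊤)
  monic : m.Monic
  coprime : IsCoprime m u

namespace LineData

/-- Pullback along a morphism. -/
noncomputable def map {X X' : Scheme.{u}} (f : X' ⟶ X) (D : LineData X) : LineData X' where
  m := D.m.map f.appTop.hom
  u := D.u.map f.appTop.hom
  γ := D.γ.map f.appTop.hom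
  monic := D.monic.map _
  coprime := D.coprime.polynomial_map _

lemma map_map {X X' X'' : Scheme.{u}} (g : X'' ⟶ X') (f : X' ⟶ X) (D : LineData X) :
    (D.map f).map g = D.map (g ≫ f) := by
  ext1 <;> simp only [map, Polynomial.map_map, Scheme.Hom.comp_appTop, CommRingCat.hom_comp]

/-- The framing of `D` is the product of the coprime equations of `D₁` and `D₂`. -/
structure IsProd {X : Scheme.{u}} (D D₁ D₂ : LineData X) : Prop where
  m : D.m = D₁.m * D₂.m
  u : D.u = 1
  u₁ : D₁.u = D₂.m
  u₂ : D₂.u = D₁.m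
  γ₁ : D₁.γ = D.γ
  γ₂ : D₂.γ = D.γ

lemma IsProd.map {X X' : Scheme.{u}} {D D₁ D₂ : LineData X} (h : IsProd D D₁ D₂) (f : X' ⟶ X) :
    IsProd (D.map f) (D₁.map f) (D₂.map f) where
  m := (congrArg (Polynomial.map _) h.m).trans (Polynomial.map_mul _)
  u := (congrArg (Polynomial.map _) h.u).trans (Polynomial.map_one _)
  u₁ := congrArg (Polynomial.map _) h.u₁
  u₂ := congrArg (Polynomial.map _) h.u₂
  γ₁ := congrArg (Polynomial.map _) h.γ₁
  γ₂ := congrArg (Polynomial.map _) h.γ₂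

variable {X X' Y Y' : Over B}

/-- The support of the correspondence is mapped to the image of `j`. -/
def MapsTo (D : LineData X.left) (j : Y ⟶ line B) : Prop :=
  ∀ z ∈ polyZeros X.left D.m, toLine X D.γ z ∈ Set.range j.left

lemma map_mem_polyZeros (f : X' ⟶ X) (p : Polynomial Γ(X.left, ⊤)) (z : Aff 1 X'.left) :
    z ∈ polyZeros X'.left (p.map f.left.appTop.hom) ↔
      AffineSpace.map (ULift.{u} (Fin 1)) f.left z ∈ polyZeros X.left p := by
  rw [mem_polyZeros, mem_polyZeros, ← map_appTop_polyFn, notMem_basicOpen_appTop]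

lemma MapsTo.map {D : LineData X.left} {j : Y ⟶ line B} (h : D.MapsTo j) (f : X' ⟶ X) :
    (D.map f.left).MapsTo (X := X') j := by
  intro z hz
  change toLine X' (D.γ.map _) z ∈ _
  rw [← map_toLine, Scheme.Hom.comp_apply]
  exact h _ ((map_mem_polyZeros f _ z).mp hz)

lemma MapsTo.comp {D : LineData X.left} {j : Y ⟶ line B} (h : D.MapsTo j) {f : Y ⟶ Y'}
    {j' : Y' ⟶ line B} (hf : f ≫ j' = j) : D.MapsTo j' := by
  intro z hz
  obtain ⟨y, hy⟩ := h z hz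
  exact ⟨f.left y, by rw [← hy, ← Scheme.Hom.comp_apply, ← Over.comp_left, hf]⟩

/-- The neighbourhood of the support on which the morphism to `Y` is defined. -/
noncomputable def nbhd (D : LineData X.left) (j : Y ⟶ line B) [IsOpenImmersion j.left] :
    (Aff 1 X.left).Opens :=
  (Aff 1 X.left).basicOpen (polyFn X.left D.u) ⊓ toLine X D.γ ⁻¹ᵁ j.left.opensRange

section
variable (D : LineData X.left) (j : Y ⟶ line B) [IsOpenImmersion j.left]

lemma mem_nbhd {z : Aff 1 X.left} : z ∈ D.nbhd j ↔
    z ∈ (Aff 1 X.left).basicOpen (polyFn X.left D.u) ∧ toLine X D.γ z ∈ Set.range j.left := Iff.rfl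

/-- Since the neighbourhood commutes with base change, precomposition with a morphism stays within
the polynomial description. -/
lemma nbhd_map (f : X' ⟶ X) : nbhd (X := X') (D.map f.left) j =
    AffineSpace.map (ULift.{u} (Fin 1)) f.left ⁻¹ᵁ D.nbhd j := by
  rw [nbhd, nbhd, Scheme.Hom.preimage_inf, Scheme.preimage_basicOpen_top, map_appTop_polyFn,
    ← Scheme.Hom.comp_preimage, map_toLine]
  rfl

/-- If both polynomials vanished at `z`, a Bézout relation would put 1 into the maximal ideal of the
local ring at `z`. -/
lemma mem_basicOpen_of_isCoprime {S : Scheme.{u}} {p q : Polynomial Γ(S, ⊤)} (h : IsCoprime p q)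
    {z : Aff 1 S} (hz : z ∈ polyZeros S p) : z ∈ (Aff 1 S).basicOpen (polyFn S q) := by
  obtain ⟨a, b, h⟩ := h
  rw [mem_polyZeros, Scheme.mem_basicOpen_top] at hz
  rw [Scheme.mem_basicOpen_top]
  by_contra hq
  have h2 := congr((Aff 1 S).presheaf.germ ⊤ z trivial (polyFn S $h))
  rw [map_add, map_mul, map_mul, map_add, map_mul, map_mul, map_one, map_one] at h2
  refine (IsLocalRing.maximalIdeal.isMaximal ((Aff 1 S).presheaf.stalk z)).ne_top
    ((Ideal.eq_top_iff_one _).mpr ?_)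
  rw [← h2]
  exact Ideal.add_mem _ (Ideal.mul_mem_left _ _ hz) (Ideal.mul_mem_left _ _ hq)

/-- The morphism to `Y`. -/
noncomputable def toTarget : (D.nbhd j).toScheme ⟶ Y.left :=
  IsOpenImmersion.lift j.left ((D.nbhd j).ι ≫ toLine X D.γ) (by
    rintro _ ⟨z, rfl⟩
    exact ((D.mem_nbhd j).mp z.2).2)

lemma toTarget_comp : D.toTarget j ≫ j.left = (D.nbhd j).ι ≫ toLine X D.γ :=
  IsOpenImmersion.lift_fac _ _ _

/-- The projection is a monomorphism, being a base change of an open immersion, and it has a section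
because `i` factors through `W`. -/
lemma isIso_snd_ι {A T : Scheme.{u}} (W : A.Opens) (i : T ⟶ A) (h : Set.range i ⊆ W) :
    IsIso (pullback.snd W.ι i) := by
  have hs : pullback.lift (IsOpenImmersion.lift W.ι i (by simpa using h)) (𝟙 T) (by simp) ≫
      pullback.snd W.ι i = 𝟙 T := pullback.lift_snd _ _ _
  have : IsSplitEpi (pullback.snd W.ι i) := ⟨⟨⟨_, hs⟩⟩⟩
  exact isIso_of_mono_of_isSplitEpi _

/-- The framed correspondence of level one given by polynomials. -/
noncomputable def corr (h : D.MapsTo j) : Corr 1 X Y where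
  W := (D.nbhd j).toScheme
  p := (D.nbhd j).ι
  Z := polyZeros X.left D.m
  φ := fun _ => (D.nbhd j).ι.appTop (polyFn X.left (D.m * D.u))
  g := D.toTarget j
  g_over := by
    rw [← Over.w j, ← Category.assoc, toTarget_comp]
    change ((D.nbhd j).ι ≫ toLine X D.γ) ≫ Aff.pr 1 B = _
    rw [Category.assoc, toLine, Aff.lift_pr]
  finite := isFinite_polyZeros D.monic
  etale := inferInstance
  iso := isIso_snd_ι _ _ (by
    rw [range_redι]
    exact fun z hz => ⟨mem_basicOpen_of_isCoprime D.coprime hz, h z hz⟩)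
  vanish := by
    intro w
    rw [vanishes_pullback (D.nbhd j).ι (fun _ : Fin 1 => polyFn X.left (D.m * D.u))]
    -- The neighbourhood lies in the locus where `u` is invertible, so there `m * u` has the same
    -- zeros as `m`.
    have hw := ((D.mem_nbhd j).mp w.2).1
    rw [mem_polyZeros, Vanishes, forall_const, map_mul, Scheme.basicOpen_mul]
    exact not_congr (iff_self_and.mpr fun _ => hw)

lemma isPullback_resLE_of_eq {S T : Scheme.{u}} (f : S ⟶ T) {U : T.Opens} {V : S.Opens}
    (h : V = f ⁻¹ᵁ U) : IsPullback (f.resLE U V h.le) V.ι U.ι f := by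
  subst h
  rw [Scheme.Hom.resLE_eq_morphismRestrict]
  exact isPullback_morphismRestrict f U

/-- Precomposition of a correspondence given by polynomials with a morphism. -/
lemma ofHom_comp_corr (f : X' ⟶ X) (h : D.MapsTo j) :
    ZF.comp (Nat.zero_add 1) (ZF.ofHom f) (ZF.of (D.corr j h)) =
      ZF.of (corr (X := X') (D.map f.left) j (h.map f)) := by
  rw [ZF.ofHom, ZF.comp_of]
  have hp := isPullback_resLE_of_eq _ (D.nbhd_map j f)
  refine (ZF.of_eq (Corr.equivalent_comp_of_isPullback (Nat.zero_add 1)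
    (corr (X := X') (D.map f.left) j (h.map f)) (Corr.ofHom f) (D.corr j h)
    ((nbhd (X := X') (D.map f.left) j).ι ≫ Aff.pr 1 X'.left)
    (Scheme.Hom.resLE _ _ _ (D.nbhd_map j f).le) ?_ ?_ (fun i => i.elim0) (fun i => ?_)
    (fun i => i.elim0) (fun i => ?_) ?_)).symm
  -- The neighbourhood over `X'` is the base change of the one over `X`, first along the open
  -- inclusion and then along the projection of the affine line.
  · exact (hp.paste_vert (AffineSpace.isPullback_map f.left).flip.flip).flip
  · rw [Corr.ofHom_p_pr]
    exact Category.comp_id ((nbhd (X := X') (D.map f.left) j).ι ≫ Aff.pr 1 X'.left)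
  · rw [Subsingleton.elim (Fin.cast (Nat.zero_add 1) (Fin.natAdd 0 i)) i]
    change (Scheme.Hom.resLE _ _ _ _).appTop ((D.nbhd j).ι.appTop _) = _
    rw [← appTop_comp_apply, hp.w, appTop_comp_apply]
    exact congrArg _ (AffineSpace.map_appTop_coord f.left _)
  · change (Scheme.Hom.resLE _ _ _ _).appTop ((D.nbhd j).ι.appTop _) = _
    rw [← appTop_comp_apply, hp.w, appTop_comp_apply, map_appTop_polyFn, Polynomial.map_mul]
    rfl
  · rw [← cancel_mono j.left]
    change (_ ≫ D.toTarget j) ≫ _ = toTarget (X := X') _ _ ≫ _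
    rw [Category.assoc, toTarget_comp, toTarget_comp, reassoc_of% hp.w, map_toLine]
    rfl

/-- Postcomposition of a correspondence given by polynomials with a morphism of open subschemes of
the affine line. -/
lemma corr_comp_ofHom (h : D.MapsTo j) (f : Y ⟶ Y') (j' : Y' ⟶ line B) [IsOpenImmersion j'.left]
    (hf : f ≫ j' = j) :
    ZF.comp (Nat.add_zero 1) (ZF.of (D.corr j h)) (ZF.ofHom f) =
      ZF.of (D.corr j' (h.comp hf)) := by
  rw [ZF.ofHom, ZF.comp_of]
  -- `c` keeps the smaller neighbourhood of `D.corr j h` but has the new target. It is literally the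
  -- composite, and it refines `D.corr j'`, whose neighbourhood is larger.
  let c : Corr 1 X Y' :=
    { D.corr j h with
      g := D.toTarget j ≫ f.left
      g_over := by
        refine (Category.assoc (D.toTarget j) _ _).trans ?_
        rw [Over.w]
        exact (D.corr j h).g_over }
  have hle : D.nbhd j ≤ D.nbhd j' := by
    intro z hz
    obtain ⟨h1, y, hy⟩ := hz
    exact ⟨h1, f.left y, by rw [← hy, ← Scheme.Hom.comp_apply, ← Over.comp_left, hf]⟩
  have h1 : c.Equivalent (D.corr j' (h.comp hf)) := by
    refine ⟨c, rfl, rfl, ⟨⟨𝟙 _, by simp, by simp, by simp⟩⟩, ⟨⟨Scheme.homOfLE _ hle, ?_, ?_, ?_⟩⟩⟩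
    · exact Scheme.homOfLE_ι _ _
    · intro i
      change (Scheme.homOfLE _ hle).appTop ((D.nbhd j').ι.appTop _) = (D.nbhd j).ι.appTop _
      rw [← appTop_comp_apply, Scheme.homOfLE_ι]
    · rw [← cancel_mono j'.left]
      change (Scheme.homOfLE _ hle ≫ D.toTarget j') ≫ _ = (D.toTarget j ≫ f.left) ≫ _
      rw [Category.assoc, toTarget_comp, Scheme.homOfLE_ι_assoc, Category.assoc, ← Over.comp_left,
        hf, toTarget_comp]
  refine (ZF.of_eq (Corr.equivalent_comp_of_isPullback (Nat.add_zero 1) c (D.corr j h)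
    (Corr.ofHom f) (𝟙 _) (D.toTarget j) ?_ ?_ (fun i => ?_) (fun i => i.elim0) (fun i => ?_)
    (fun i => i.elim0) rfl)).symm.trans (ZF.of_eq h1)
  · rw [Corr.ofHom_p_pr]
    change IsPullback (𝟙 _) (D.toTarget j) (D.toTarget j) (𝟙 Y.left)
    exact IsPullback.of_horiz_isIso ⟨by simp⟩
  · exact Category.id_comp _
  · exact congr($(Scheme.Hom.id_appTop (X := (D.nbhd j).toScheme)) _)
  · exact congr($(Scheme.Hom.id_appTop (X := (D.nbhd j).toScheme)) _)

/-- A correspondence whose framing is a product of coprime monic polynomials is the sum of the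
correspondences supported on the vanishing loci of the factors. -/
lemma of_corr_eq_add (D₁ D₂ : LineData X.left) (H : IsProd D D₁ D₂)
    (h : D.MapsTo j) (h₁ : D₁.MapsTo j) (h₂ : D₂.MapsTo j) :
    ZF.of (D.corr j h) = ZF.of (D₁.corr j h₁) + ZF.of (D₂.corr j h₂) := by
  -- Both summands carry the full framing of `D`. The factor `u` of each one merely removes the
  -- zeros of the other factor from the neighbourhood, so each is a restriction of `D`.
  have key (D' : LineData X.left) (h' : D'.MapsTo j) (hm : D'.m * D'.u = D.m * D.u)
      (hγ : D'.γ = D.γ) : Nonempty ((D'.corr j h').Restriction (D.corr j h)) := by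
    have hle : D'.nbhd j ≤ D.nbhd j := by
      intro z hz
      rw [mem_nbhd, hγ] at hz
      refine ⟨?_, hz.2⟩
      rw [H.u, map_one, Scheme.basicOpen_of_isUnit _ isUnit_one]
      trivial
    refine ⟨⟨Scheme.homOfLE _ hle, Scheme.homOfLE_ι _ _, ?_, ?_⟩⟩
    · intro i
      change (Scheme.homOfLE _ hle).appTop ((D.nbhd j).ι.appTop _) = (D'.nbhd j).ι.appTop _
      rw [← appTop_comp_apply, Scheme.homOfLE_ι, hm]
    · rw [← cancel_mono j.left]
      change (Scheme.homOfLE _ hle ≫ D.toTarget j) ≫ _ = D'.toTarget j ≫ _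
      rw [Category.assoc, toTarget_comp, Scheme.homOfLE_ι_assoc, toTarget_comp, hγ]
  refine ZF.of_add ⟨?_, ?_, key D₁ h₁ (by rw [H.m, H.u, H.u₁, mul_one]) H.γ₁,
    key D₂ h₂ (by rw [H.m, H.u, H.u₂, mul_one, mul_comm]) H.γ₂⟩
  · ext z
    change z ∉ (Aff 1 X.left).basicOpen _ ↔ z ∉ (Aff 1 X.left).basicOpen _ ∨
      z ∉ (Aff 1 X.left).basicOpen _
    rw [H.m, map_mul, Scheme.basicOpen_mul, ← not_and_or]
    rfl
  · rw [Set.disjoint_left]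
    intro z hz hz'
    exact hz' (mem_basicOpen_of_isCoprime (H.u₁ ▸ D₁.coprime) hz)

end

end LineData

/-! ### Morphisms of pairs given by polynomials, and coprimality criteria for them. -/

instance (Q : Pair B) (j : Q.X ⟶ line B) [IsOpenImmersion j.left] :
    IsOpenImmersion (Q.incl ≫ j).left :=
  inferInstanceAs (IsOpenImmersion (Q.V.ι ≫ j.left))

/-- The coordinate function of a morphism to the affine line. -/
noncomputable def coordOf {X : Over B} (e : X ⟶ line B) : Γ(X.left, ⊤) :=
  e.left.appTop (Aff.x B 0)

lemma coordOf_comp {X X' : Over B} (f : X' ⟶ X) (e : X ⟶ line B) :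
    coordOf (f ≫ e) = f.left.appTop (coordOf e) :=
  appTop_comp_apply f.left e.left _

/-- A polynomial over the base, regarded as a polynomial over the functions on `X`. -/
noncomputable def pullPoly (X : Over B) (a : Polynomial Γ(B, ⊤)) : Polynomial Γ(X.left, ⊤) :=
  a.map X.hom.appTop.hom

lemma map_pullPoly {X X' : Over B} (f : X' ⟶ X) (a : Polynomial Γ(B, ⊤)) :
    (pullPoly X a).map f.left.appTop.hom = pullPoly X' a := by
  rw [pullPoly, pullPoly, Polynomial.map_map, ← CommRingCat.hom_comp, ← Scheme.Hom.comp_appTop,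
    Over.w]

/-- The value at the coordinate is the pullback of `a` along `e`, a function without zeros. -/
lemma isUnit_eval_coordOf {X : Over B} (e : X ⟶ line B) (a : Polynomial Γ(B, ⊤))
    (h : ∀ x, e.left x ∈ (Aff 1 B).basicOpen (polyFn B a)) :
    IsUnit ((pullPoly X a).eval (coordOf e)) := by
  have h1 : (pullPoly X a).eval (coordOf e) = e.left.appTop (polyFn B a) := by
    rw [pullPoly, Polynomial.eval_map, appTop_polyFn]
    congr 2
    rw [← Over.w e]
    rfl
  rw [h1]
  refine X.left.toRingedSpace.isUnit_of_isUnit_germ _ _ fun x hx => ?_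
  have := h x
  rwa [← Scheme.Hom.mem_preimage, Scheme.preimage_basicOpen_top, Scheme.mem_basicOpen_top] at this

/-- Modulo `m` one has γ ≡ y, hence p(γ) ≡ p(y), which is a unit. -/
lemma _root_.Polynomial.isCoprime_comp_of_dvd {R : Type*} [CommRing R] {m γ p : Polynomial R}
    {y : R} (h : m ∣ γ - Polynomial.C y) (hy : IsUnit (p.eval y)) : IsCoprime m (p.comp γ) := by
  have h1 : γ - Polynomial.C y ∣ p.comp γ - Polynomial.C (p.eval y) := by
    -- The coefficients of `p` are moved into `R[X]` so that `p` can be evaluated at the polynomials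
    -- `γ` and `C y`.
    have := Polynomial.sub_dvd_eval_sub γ (Polynomial.C y) (p.map Polynomial.C)
    rwa [Polynomial.eval_map, Polynomial.eval_map, Polynomial.eval₂_at_apply] at this
  obtain ⟨c, hc⟩ := h.trans h1
  have h2 : p.comp γ = Polynomial.C (p.eval y) + m * c := by rw [← hc]; ring
  rw [h2]
  exact (((isCoprime_one_right (x := m)).of_isCoprime_of_dvd_right
    (hy.map Polynomial.C).dvd)).add_mul_left_right c

namespace LineData

section
variable {X Y : Over B}

/-- On the support `m` vanishes, so a(γ) does not, and `γ` lands in the non-vanishing locus of `a`.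
-/
lemma mapsTo_of_isCoprime {D : LineData X.left} {j : Y ⟶ line B} (a : Polynomial Γ(B, ⊤))
    (ha : ∀ z ∈ (Aff 1 B).basicOpen (polyFn B a), z ∈ Set.range j.left)
    (h : IsCoprime D.m ((pullPoly X a).comp D.γ)) : D.MapsTo j := by
  intro z hz
  apply ha
  have := mem_basicOpen_of_isCoprime h hz
  rw [pullPoly, ← toLine_appTop_polyFn, ← Scheme.preimage_basicOpen_top] at this
  exact this

lemma toLine_C_coordOf (j : X ⟶ line B) :
    toLine X (Polynomial.C (coordOf j)) = Aff.pr 1 X.left ≫ j.left := by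
  apply Aff.hom_ext
  · rw [toLine, Aff.lift_pr, Category.assoc, ← Over.w j]
    rfl
  · intro i
    rw [toLine, Aff.lift_x, polyFn_C, coordOf, appTop_comp_apply, Subsingleton.elim i 0]

/-- The neighbourhood of `D` is an open part of that of σ and serves as the common one. A `γ`
constant in the variable gives the projection to `X`, because `j` is a monomorphism. -/
lemma of_corr_eq_sigma (D : LineData X.left) (j : X ⟶ line B) [IsOpenImmersion j.left]
    (h : D.MapsTo j) (hm : D.m = Polynomial.X) (hu : D.u = 1)
    (hγ : D.γ = Polynomial.C (coordOf j)) : ZF.of (D.corr j h) = ZF.sigma X := by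
  refine ZF.of_eq ⟨D.corr j h, rfl, ?_, ⟨⟨𝟙 _, by simp, by simp, by simp⟩⟩,
    ⟨⟨(D.nbhd j).ι, ?_, ?_, ?_⟩⟩⟩
  · ext z
    change z ∉ (Aff 1 X.left).basicOpen _ ↔ z ∈ Set.range (Aff.lift (n := 1) _ _ ≫ 𝟙 (Aff 1 X.left))
    rw [Category.comp_id, Corr.range_zero, hm, polyFn_X]
    exact ⟨fun h i => by rwa [Subsingleton.elim i 0], fun h => h 0⟩
  · exact Category.comp_id _
  · intro i
    change _ = (D.nbhd j).ι.appTop _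
    rw [hm, hu, mul_one, polyFn_X, Subsingleton.elim i 0]
    rfl
  · rw [← cancel_mono j.left]
    change ((D.nbhd j).ι ≫ Aff.pr 1 X.left) ≫ _ = D.toTarget j ≫ _
    rw [toTarget_comp, hγ, toLine_C_coordOf, Category.assoc]

end

variable {P P' Q Q' : Pair B}

/-- The correspondence defined by polynomials is a morphism of pairs. -/
def PairMapsTo (D : LineData P.X.left) (j : Q.X ⟶ line B) : Prop :=
  D.MapsTo j ∧ MapsTo (X := P.sub) (D.map P.incl.left) (Q.incl ≫ j)

lemma PairMapsTo.map {D : LineData P.X.left} {j : Q.X ⟶ line B} (h : D.PairMapsTo j)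
    (f : Pair.Hom P' P) : PairMapsTo (P := P') (D.map f.f.left) j := by
  refine ⟨h.1.map f.f, ?_⟩
  have := h.2.map f.res
  rw [map_map] at this ⊢
  have hw : f.res.left ≫ P.incl.left = P'.incl.left ≫ f.f.left := by simp
  rwa [hw] at this

lemma PairMapsTo.comp {D : LineData P.X.left} {j : Q.X ⟶ line B} (h : D.PairMapsTo j)
    {f : Pair.Hom Q Q'} {j' : Q'.X ⟶ line B} (hf : f.f ≫ j' = j) : D.PairMapsTo j' := by
  refine ⟨h.1.comp hf, h.2.comp (f := f.res) ?_⟩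
  rw [← hf]
  ext1
  simp

lemma of_corr_congr {X Y : Over B} {D D' : LineData X.left} {j j' : Y ⟶ line B}
    [IsOpenImmersion j.left] [IsOpenImmersion j'.left] (h : D.MapsTo j) (h' : D'.MapsTo j')
    (hD : D = D') (hj : j = j') : ZF.of (D.corr j h) = ZF.of (D'.corr j' h') := by
  subst hD hj
  rfl

section
variable (D : LineData P.X.left) (j : Q.X ⟶ line B) [IsOpenImmersion j.left]

/-- The morphism of pairs of degree one given by polynomials. -/
noncomputable def pairCorr (h : D.PairMapsTo j) : ZFpr 1 P Q :=
  ⟨(ZF.of (D.corr j h.1), ZF.of (corr (X := P.sub) (D.map P.incl.left) (Q.incl ≫ j) h.2)), by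
    rw [mem_ZFpr]
    change ZF.comp _ _ (ZF.of (D.corr j h.1)) =
      ZF.comp _ (ZF.of (corr (X := P.sub) (D.map P.incl.left) (Q.incl ≫ j) h.2)) _
    rw [ofHom_comp_corr, corr_comp_ofHom (X := P.sub) _ (Q.incl ≫ j) h.2 Q.incl j rfl]⟩

lemma ofHom_comp_pairCorr (f : Pair.Hom P' P) (h : D.PairMapsTo j) :
    ZFpr.comp (Nat.zero_add 1) (ZFpr.ofHom f) (D.pairCorr j h) =
      pairCorr (P := P') (D.map f.f.left) j (h.map f) := by
  ext1
  refine Prod.ext (ofHom_comp_corr D j f.f h.1) ?_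
  refine (ofHom_comp_corr (X := P.sub) (D.map P.incl.left) (Q.incl ≫ j) f.res h.2).trans ?_
  refine of_corr_congr (X := P'.sub) _ _ ?_ rfl
  have hw : f.res.left ≫ P.incl.left = P'.incl.left ≫ f.f.left := by simp
  rw [map_map, map_map, hw]

lemma pairCorr_comp_ofHom (h : D.PairMapsTo j) (f : Pair.Hom Q Q') (j' : Q'.X ⟶ line B)
    [IsOpenImmersion j'.left] (hf : f.f ≫ j' = j) :
    ZFpr.comp (Nat.add_zero 1) (D.pairCorr j h) (ZFpr.ofHom f) = D.pairCorr j' (h.comp hf) := by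
  ext1
  refine Prod.ext (corr_comp_ofHom D j h.1 f.f j' hf) ?_
  refine corr_comp_ofHom (X := P.sub) (D.map P.incl.left) (Q.incl ≫ j) h.2 f.res (Q'.incl ≫ j') ?_
  rw [← hf]
  ext1
  simp

lemma pairCorr_eq_add (D₁ D₂ : LineData P.X.left) (H : IsProd D D₁ D₂) (h : D.PairMapsTo j)
    (h₁ : D₁.PairMapsTo j) (h₂ : D₂.PairMapsTo j) :
    D.pairCorr j h = D₁.pairCorr j h₁ + D₂.pairCorr j h₂ := by
  ext1
  exact Prod.ext (of_corr_eq_add D j D₁ D₂ H h.1 h₁.1 h₂.1)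
    (of_corr_eq_add (X := P.sub) (D.map P.incl.left) (Q.incl ≫ j) (D₁.map P.incl.left)
      (D₂.map P.incl.left) (H.map _) h.2 h₁.2 h₂.2)

end

lemma map_γ_eq {X X' : Over B} (f : X' ⟶ X) (j : X ⟶ line B) {D : LineData X.left}
    (hγ : D.γ = Polynomial.C (coordOf j)) :
    (D.map f.left).γ = Polynomial.C (coordOf (f ≫ j)) := by
  rw [LineData.map, hγ, Polynomial.map_C, coordOf_comp]

lemma pairCorr_eq_sigma (D : LineData P.X.left) (j : P.X ⟶ line B) [IsOpenImmersion j.left]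
    (h : D.PairMapsTo j) (hm : D.m = Polynomial.X) (hu : D.u = 1)
    (hγ : D.γ = Polynomial.C (coordOf j)) : D.pairCorr j h = ZFpr.sigma P := by
  ext1
  refine Prod.ext (of_corr_eq_sigma D j h.1 hm hu hγ) (of_corr_eq_sigma (X := P.sub) _ _ h.2
    ((congrArg (Polynomial.map _) hm).trans (Polynomial.map_X _))
    ((congrArg (Polynomial.map _) hu).trans (Polynomial.map_one _)) (map_γ_eq P.incl j hγ))

/-- The image of `j` contains the non-vanishing locus of `a`, and `Q.V` contains the preimage of the
non-vanishing locus of `s`. -/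
structure Cuts (j : Q.X ⟶ line B) (a s : Polynomial Γ(B, ⊤)) : Prop where
  mem_range : ∀ z ∈ (Aff 1 B).basicOpen (polyFn B a), z ∈ Set.range j.left
  mem_V : ∀ y, j.left y ∈ (Aff 1 B).basicOpen (polyFn B s) → y ∈ Q.V

/-- The morphism `e` maps `P` to the pair of the non-vanishing loci of `a` and `a * s`. -/
structure Avoids (e : P.X ⟶ line B) (a s : Polynomial Γ(B, ⊤)) : Prop where
  mem_left : ∀ x, e.left x ∈ (Aff 1 B).basicOpen (polyFn B a)
  mem_right : ∀ x ∈ P.V, e.left x ∈ (Aff 1 B).basicOpen (polyFn B s)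

section
variable {a s : Polynomial Γ(B, ⊤)} {j : Q.X ⟶ line B} {e : P.X ⟶ line B}

/-- Coprimality to `a` places the support over `Q.X`; coprimality to `s` then places it over `Q.V`.
-/
lemma mapsTo_incl_comp {X : Over B} {D : LineData X.left} (hQ : Cuts j a s)
    (h₁ : IsCoprime D.m ((pullPoly X a).comp D.γ)) (h₂ : IsCoprime D.m ((pullPoly X s).comp D.γ)) :
    D.MapsTo (Q.incl ≫ j) := by
  intro z hz
  obtain ⟨y, hy⟩ := mapsTo_of_isCoprime a hQ.mem_range h₁ z hz
  have h3 := mem_basicOpen_of_isCoprime h₂ hz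
  rw [pullPoly, ← toLine_appTop_polyFn, ← Scheme.preimage_basicOpen_top] at h3
  have h4 : toLine X D.γ z ∈ (Aff 1 B).basicOpen (polyFn B s) := h3
  rw [← hy] at h4
  exact ⟨⟨y, hQ.mem_V y h4⟩, hy⟩

/-- On the support the map to the line agrees with `e`, and `e` already respects the pairs. -/
lemma pairMapsTo_of_graph (D : LineData P.X.left) (hQ : Cuts j a s) (hP : Avoids e a s)
    (h : D.m ∣ D.γ - Polynomial.C (coordOf e)) : D.PairMapsTo j := by
  have h' : (D.map P.incl.left).m ∣
      (D.map P.incl.left).γ - Polynomial.C (coordOf (P.incl ≫ e)) := by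
    have := Polynomial.map_dvd P.incl.left.appTop.hom h
    rw [Polynomial.map_sub, Polynomial.map_C] at this
    rw [coordOf_comp]
    exact this
  exact ⟨mapsTo_of_isCoprime a hQ.mem_range (Polynomial.isCoprime_comp_of_dvd h (isUnit_eval_coordOf e a hP.mem_left)),
    mapsTo_incl_comp (X := P.sub) hQ (Polynomial.isCoprime_comp_of_dvd h' (isUnit_eval_coordOf (P.incl ≫ e) a fun x => hP.mem_left x.1))
      (Polynomial.isCoprime_comp_of_dvd h' (isUnit_eval_coordOf (P.incl ≫ e) s fun x => hP.mem_right x.1 x.2))⟩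

/-- The residue 1 modulo `a` keeps the support off the zeros of `a`. The residue `X - y` modulo `s`
is prime to `s` wherever s(y) is invertible, that is over `P.V`, which is all the second component
needs. -/
lemma pairMapsTo_of_dvd (D : LineData P.X.left) (hγ : D.γ = Polynomial.X) (hQ : Cuts j a s)
    (hP : ∀ x ∈ P.V, e.left x ∈ (Aff 1 B).basicOpen (polyFn B s)) (h₁ : pullPoly P.X a ∣ D.m - 1)
    (h₂ : pullPoly P.X s ∣ D.m - (Polynomial.X - Polynomial.C (coordOf e))) :
    D.PairMapsTo j := by
  have hc : IsCoprime D.m (pullPoly P.X a) := by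
    obtain ⟨c, hc⟩ := h₁
    exact ⟨1, -c, by linear_combination hc⟩
  refine ⟨mapsTo_of_isCoprime a hQ.mem_range (by rwa [hγ, Polynomial.comp_X]),
    mapsTo_incl_comp (X := P.sub) hQ ?_ ?_⟩
  · change IsCoprime _ ((pullPoly P.sub a).comp (D.γ.map _))
    rw [hγ, Polynomial.map_X, Polynomial.comp_X, ← map_pullPoly P.incl]
    exact hc.polynomial_map _
  · change IsCoprime (D.m.map P.incl.left.appTop.hom) ((pullPoly P.sub s).comp (D.γ.map _))
    rw [hγ, Polynomial.map_X, Polynomial.comp_X]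
    -- Over `P.V` the polynomials `X - y` and `s` are coprime; this transfers to `m`, which differs
    -- from `X - y` by a multiple of `s`.
    have h4 := Polynomial.isCoprime_comp_of_dvd
      (dvd_refl (Polynomial.X - Polynomial.C (coordOf (P.incl ≫ e))))
      (isUnit_eval_coordOf (P.incl ≫ e) s fun x => hP x.1 x.2)
    rw [Polynomial.comp_X] at h4
    have h5 := Polynomial.map_dvd P.incl.left.appTop.hom h₂
    rw [map_pullPoly P.incl, Polynomial.map_sub, Polynomial.map_sub, Polynomial.map_X,
      Polynomial.map_C] at h5
    obtain ⟨c, hc⟩ := h5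
    rw [sub_eq_iff_eq_add'] at hc
    rw [hc]
    refine IsCoprime.add_mul_right_left ?_ c |> fun h => by rwa [mul_comm c] at h
    rw [coordOf_comp] at h4
    exact h4

lemma pairMapsTo_diag {Y : Over B} {D : LineData P.X.left} {j : Y ⟶ line B} (h : D.MapsTo j) :
    PairMapsTo (Q := Pair.diag Y) D j := by
  refine ⟨h, fun z hz => ?_⟩
  obtain ⟨y, hy⟩ := h.map P.incl z hz
  exact ⟨⟨y, trivial⟩, hy⟩

end

end LineData

/-! ### Homotopies, vanishing classes, and the reduction to σ. -/

variable {n : ℕ} {P Q : Pair B}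

lemma cls_add_of_eq_zero (x : ZFpr n P Q) {y : ZFpr n P Q} (hy : cls y = 0) :
    cls (x + y) = cls x := by
  have h : (QuotientAddGroup.mk y : ZFbarpr n P Q) ∈ idIdeal n P Q :=
    (QuotientAddGroup.eq_zero_iff _).mp hy
  refine QuotientAddGroup.eq_iff_sub_mem.mpr ?_
  rwa [← QuotientAddGroup.mk_sub, add_sub_cancel_left]

/-- Homotopic morphisms of pairs have the same class. -/
lemma cls_constSection_comp (H : ZFpr n P.A1 Q) :
    cls (ZFpr.comp (Nat.zero_add n) (ZFpr.ofHom (P.constSection 0)) H) =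
      cls (ZFpr.comp (Nat.zero_add n) (ZFpr.ofHom (P.constSection 1)) H) := by
  refine congrArg (QuotientAddGroup.mk (s := idIdeal n P Q)) ?_
  rw [QuotientAddGroup.eq_iff_sub_mem]
  exact ⟨H, rfl⟩

/-- A morphism of pairs that factors through a pair `(X, X)` has class zero. -/
lemma cls_comp_diag {p q : ℕ} (h : p + q = n) {X : Over B} (hX : IsSmoothVariety X)
    (a : ZFpr p P (Pair.diag X)) (b : ZFpr q (Pair.diag X) Q) : cls (ZFpr.comp h a b) = 0 := by
  rw [cls, QuotientAddGroup.eq_zero_iff]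
  exact AddSubgroup.subset_closure ⟨p, q, h, X, hX, a, b, rfl⟩

namespace LineData

open Polynomial in
lemma appTop_lift_map_pr {X : Scheme.{u}} (c : Γ(X, ⊤)) (p : Γ(X, ⊤)[X]) :
    (p.map (Aff.pr 1 X).appTop.hom).map (Aff.lift (n := 1) (𝟙 X) fun _ => c).appTop.hom = p := by
  rw [Polynomial.map_map, ← CommRingCat.hom_comp, ← Scheme.Hom.comp_appTop, Aff.lift_pr,
    Scheme.Hom.id_appTop]
  exact Polynomial.map_id

/-- A homotopy is given by polynomials over the functions on `𝔸¹ × P`. The endpoints enter through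
equations, so identifying them is a polynomial identity after setting the parameter to 0 or 1. -/
lemma cls_pairCorr_homotopy (H : LineData P.A1.X.left) (j : Q.X ⟶ line B) [IsOpenImmersion j.left]
    (h : PairMapsTo (P := P.A1) H j) {D₀ D₁ : LineData P.X.left}
    (e₀ : H.map (Aff.lift (𝟙 _) fun _ => 0) = D₀) (e₁ : H.map (Aff.lift (𝟙 _) fun _ => 1) = D₁)
    (h₀ : D₀.PairMapsTo j) (h₁ : D₁.PairMapsTo j) :
    cls (D₀.pairCorr j h₀) = cls (D₁.pairCorr j h₁) := by
  subst e₀ e₁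
  have := cls_constSection_comp (pairCorr (P := P.A1) H j h)
  rw [ofHom_comp_pairCorr, ofHom_comp_pairCorr] at this
  exact this

/-- When the whole support lands in `P.V`, and not only the part over `P.V`, the correspondence
factors through the pair (V, V), whose identity is divided out. -/
lemma cls_pairCorr_eq_zero (D : LineData P.X.left) (j : P.X ⟶ line B) [IsOpenImmersion j.left]
    (hP : IsSmoothVariety P.sub) (h : D.MapsTo (P.incl ≫ j)) (h' : D.PairMapsTo j) :
    cls (D.pairCorr j h') = 0 := by
  let b : Pair.Hom (Pair.diag P.sub) P :=
    { f := P.incl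
      le := fun x _ => x.2 }
  rw [← pairCorr_comp_ofHom D (Q := Pair.diag P.sub) (P.incl ≫ j) (pairMapsTo_diag h) b j rfl]
  exact cls_comp_diag _ hP _ _

section
variable {a s : Polynomial Γ(B, ⊤)}

lemma avoids_A1 {e : P.X ⟶ line B} (h : Avoids e a s) :
    Avoids (P := P.A1) ((Over.homMk (Aff.pr 1 P.X.left) rfl : P.A1.X ⟶ P.X) ≫ e) a s :=
  ⟨fun _ => h.mem_left _, fun _ hx => h.mem_right _ hx⟩

open Polynomial in
/-- The correspondence given by a monic polynomial which is `1` on the complement of `P.X` and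
`X - y` on the complement of `P.V` is homotopic to `σ`. -/
theorem cls_pairCorr_eq_sigma (j : P.X ⟶ line B) [IsOpenImmersion j.left]
    (hsm : IsSmoothVariety P.sub) (hQ : Cuts j a s) (hP : Avoids j a s)
    {h : Γ(P.X.left, ⊤)[X]} {n : ℕ} (hm : h.Monic)
    (hhn : ((X - C (coordOf j)) * h - X ^ n).degree < (n : WithBot ℕ))
    (hhs : pullPoly P.X s * (X - C (coordOf j)) ∣ h - 1)
    (hha : pullPoly P.X a ∣ (X - C (coordOf j)) * h - 1)
    (D : LineData P.X.left) (hu : D.u = 1) (hγ : D.γ = X) (hfn : (D.m - X ^ n).degree < (n : WithBot ℕ))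
    (hfa : pullPoly P.X a ∣ D.m - 1) (hfs : pullPoly P.X s ∣ D.m - (X - C (coordOf j)))
    (hD : D.PairMapsTo j) :
    cls (D.pairCorr j hD) = cls (ZFpr.sigma P) := by
  set y := coordOf j with hy
  set F := (X - C y) * h with hF
  -- Here h = 1 + (X - y)c. This gives the coprimality of `h` and `X - y`, and `c` is used again
  -- below to deform `h` to 1.
  obtain ⟨c, hc⟩ := (dvd_mul_left _ _).trans hhs
  have hcop : IsCoprime (X - C y) h := ⟨-c, 1, by linear_combination hc⟩
  have hFs : pullPoly P.X s ∣ F - (X - C y) := by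
    have : F - (X - C y) = (X - C y) * (h - 1) := by rw [hF]; ring
    rw [this]
    exact ((dvd_mul_right _ _).trans hhs).mul_left _
  let D₁ : LineData P.X.left := ⟨F, 1, X, (monic_X_sub_C y).mul hm, isCoprime_one_right⟩
  let D₂ : LineData P.X.left := ⟨X - C y, h, X, monic_X_sub_C y, hcop⟩
  let D₃ : LineData P.X.left := ⟨h, X - C y, X, hm, hcop.symm⟩
  let D₄ : LineData P.X.left := ⟨X, 1, C y, monic_X, isCoprime_one_right⟩
  have m₁ : D₁.PairMapsTo j := pairMapsTo_of_dvd D₁ rfl hQ hP.mem_right hha hFs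
  have m₂ : D₂.PairMapsTo j := pairMapsTo_of_graph D₂ hQ hP dvd_rfl
  -- `h` is invertible modulo `a` and congruent to 1 modulo `s`, so its zeros all lie in `P.V`.
  have m₃' : D₃.MapsTo (P.incl ≫ j) := by
    obtain ⟨c₁, h₁⟩ := (dvd_mul_right _ _).trans hhs
    obtain ⟨c₂, h₂⟩ := hha
    refine mapsTo_incl_comp hQ ?_ ?_
    · change IsCoprime h (Polynomial.comp _ X)
      rw [comp_X]
      exact ⟨X - C y, -c₂, by linear_combination h₂⟩
    · change IsCoprime h (Polynomial.comp _ X)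
      rw [comp_X]
      exact ⟨1, -c₁, by linear_combination h₁⟩
  have m₃ : D₃.PairMapsTo j := (pairMapsTo_diag m₃').comp (Q := Pair.diag P.sub)
    (f := ⟨P.incl, fun x _ => x.2⟩) rfl
  have m₄ : D₄.PairMapsTo j := pairMapsTo_of_graph D₄ hQ hP (by simp [D₄, hy])
  let e : P.A1.X ⟶ line B := (Over.homMk (Aff.pr 1 P.X.left) rfl : P.A1.X ⟶ P.X) ≫ j
  have he : Avoids (P := P.A1) e a s := avoids_A1 hP
  let π : Γ(P.X.left, ⊤) →+* Γ(Aff 1 P.X.left, ⊤) := (Aff.pr 1 P.X.left).appTop.hom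
  let t : Γ(Aff 1 P.X.left, ⊤) := Aff.x P.X.left 0
  have hye : coordOf e = π y := coordOf_comp _ _
  have hpull (p : Γ(B, ⊤)[X]) : pullPoly P.A1.X p = (pullPoly P.X p).map π :=
    (map_pullPoly (Over.homMk (Aff.pr 1 P.X.left) rfl : P.A1.X ⟶ P.X) p).symm
  have ht (c : Γ(P.X.left, ⊤)) : (Aff.lift (n := 1) (𝟙 P.X.left) fun _ => c).appTop.hom t = c :=
    Aff.lift_x _ _ _
  have hπ (c : Γ(P.X.left, ⊤)) (p : Γ(P.X.left, ⊤)[X]) :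
    (p.map π).map (Aff.lift (n := 1) (𝟙 P.X.left) fun _ => c).appTop.hom = p :=
      appTop_lift_map_pr c p
  have hπ' (c r : Γ(P.X.left, ⊤)) :
      (Aff.lift (n := 1) (𝟙 P.X.left) fun _ => c).appTop.hom (π r) = r := by
    simpa using hπ c (C r)
  -- From here on the affine line matters only through the rules `ht`, `hπ`, `hπ'`: restriction to a
  -- constant section sends `t` to the constant and is a left inverse of `π`.
  clear_value π t
  have s₁ : cls (D.pairCorr j hD) = cls (D₁.pairCorr j m₁) := by
    -- The homotopy is t·m + (1 - t)·F. Writing it as `X ^ n + q` with `q` of degree below `n` shows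
    -- that it is monic; this is why both ends share the same `n`.
    let q : Γ(Aff 1 P.X.left, ⊤)[X] :=
      C t * (D.m - X ^ n).map π + (1 - C t) * (F - X ^ n).map π
    have hq : q.degree < (n : WithBot ℕ) := by
      refine (degree_add_le _ _).trans_lt (max_lt ?_ ?_)
      · rw [← smul_eq_C_mul]
        exact (degree_smul_le _ _).trans_lt (degree_map_le.trans_lt hfn)
      · rw [← C_1, ← C_sub, ← smul_eq_C_mul]
        exact (degree_smul_le _ _).trans_lt (degree_map_le.trans_lt hhn)
    have hqs : X ^ n + q = C t * D.m.map π + (1 - C t) * F.map π := by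
      simp only [q, Polynomial.map_sub, Polynomial.map_pow, Polynomial.map_X]
      ring
    let H : LineData (Aff 1 P.X.left) := ⟨X ^ n + q, 1, X, monic_X_pow_add hq, isCoprime_one_right⟩
    have hH : PairMapsTo (P := P.A1) H j := by
      refine pairMapsTo_of_dvd (P := P.A1) H rfl hQ he.mem_right ?_ ?_
      · have : X ^ n + q - 1 = C t * (D.m - 1).map π + (1 - C t) * (F - 1).map π := by
          rw [hqs, Polynomial.map_sub, Polynomial.map_sub, Polynomial.map_one]
          ring
        change _ ∣ X ^ n + q - 1
        rw [this, hpull]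
        exact dvd_add ((Polynomial.map_dvd π hfa).mul_left _)
          ((Polynomial.map_dvd π hha).mul_left _)
      · have : X ^ n + q - (X - C (π y)) =
            C t * (D.m - (X - C y)).map π + (1 - C t) * (F - (X - C y)).map π := by
          rw [hqs]
          simp only [Polynomial.map_sub, Polynomial.map_X, Polynomial.map_C]
          ring
        change _ ∣ X ^ n + q - _
        rw [hye, this, hpull]
        exact dvd_add ((Polynomial.map_dvd π hfs).mul_left _)
          ((Polynomial.map_dvd π hFs).mul_left _)
    refine (cls_pairCorr_homotopy H j hH ?_ ?_ m₁ hD).symm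
    · refine LineData.ext ?_ (Polynomial.map_one _) (Polynomial.map_X _)
      change (X ^ n + q).map _ = F
      rw [hqs]
      simp only [Polynomial.map_add, Polynomial.map_mul, Polynomial.map_sub, Polynomial.map_C,
        Polynomial.map_one, hπ, ht, C_0, zero_mul, zero_add, sub_zero, one_mul]
    · refine LineData.ext ?_ ((Polynomial.map_one _).trans hu.symm)
        ((Polynomial.map_X _).trans hγ.symm)
      change (X ^ n + q).map _ = D.m
      rw [hqs]
      simp only [Polynomial.map_add, Polynomial.map_mul, Polynomial.map_sub, Polynomial.map_C,
        Polynomial.map_one, hπ, ht, C_1, sub_self, zero_mul, add_zero, one_mul]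
  have s₂ : cls (D₁.pairCorr j m₁) = cls (D₂.pairCorr j m₂) := by
    -- The summand `D₃`, supported on the zeros of `h`, contributes zero.
    rw [pairCorr_eq_add D₁ j D₂ D₃ ⟨rfl, rfl, rfl, rfl, rfl, rfl⟩ m₁ m₂ m₃]
    exact cls_add_of_eq_zero _ (cls_pairCorr_eq_zero D₃ j hsm m₃' m₃)
  have s₄ : cls (D₂.pairCorr j m₂) = cls (D₄.pairCorr j m₄) := by
    -- The support is the graph X = t y. On it γ = t·(t y) + (1 - t²)y = y, so the map to the line
    -- stays equal to the coordinate. At t = 1 the data are (X - y, h, X), and at t = 0 they are (X,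
    -- 1, y). The second factor is 1 plus a multiple of the first, hence coprime to it.
    let H : LineData (Aff 1 P.X.left) :=
      ⟨X - C (t * π y), 1 + C t * (X - C (t * π y)) * c.map π, C t * X + C ((1 - t ^ 2) * π y),
        monic_X_sub_C _, ⟨-(C t * c.map π), 1, by ring⟩⟩
    have hH : PairMapsTo (P := P.A1) H j := by
      refine pairMapsTo_of_graph (P := P.A1) H hQ he ⟨C t, ?_⟩
      rw [hye]
      simp only [H, map_mul, map_sub, map_pow, map_one]
      ring
    refine (cls_pairCorr_homotopy H j hH (LineData.ext ?_ ?_ ?_) (LineData.ext ?_ ?_ ?_) m₄ m₂).symm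
    all_goals
      simp only [H, D₂, D₄, LineData.map, Polynomial.map_add, Polynomial.map_mul, Polynomial.map_pow, hπ, ht, hπ',
        Polynomial.map_sub, Polynomial.map_C, Polynomial.map_one, Polynomial.map_X, map_mul,
        map_sub, map_pow, map_one, map_zero]
    · ring
    · ring
    · ring
    · ring
    · linear_combination -hc
    · ring
  rw [s₁, s₂, s₄, pairCorr_eq_sigma D₄ j m₄ rfl rfl rfl]

end
end LineData
end FramedCorr

/-! ### Interpolation by monic polynomials. -/

namespace Polynomial

/-- A residue class modulo a monic polynomial contains monic representatives of every large degree: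
add `p` times a power of the variable. The bound on `n` is uniform, which later allows one degree to
serve several problems at once. -/
lemma exists_add_mul_sub_X_pow_degree_lt {R : Type*} [CommRing R] {p : R[X]} (hp : p.Monic)
    (r : R[X]) : ∃ N : ℕ, ∀ n ≥ N, ∃ g : R[X], (r + p * g - X ^ n).degree < (n : WithBot ℕ) := by
  rcases subsingleton_or_nontrivial R with hR | hR
  · exact ⟨0, fun n _ => ⟨0, by
      rw [Subsingleton.elim (r + p * 0 - X ^ n) 0, degree_zero]; exact WithBot.bot_lt_coe n⟩⟩
  refine ⟨max p.natDegree (r.natDegree + 1), fun n hn => ⟨X ^ (n - p.natDegree), ?_⟩⟩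
  have hpn : p.natDegree ≤ n := (le_max_left _ _).trans hn
  have hrn : r.natDegree < n := (le_max_right _ _).trans hn
  have hm : (p * X ^ (n - p.natDegree)).Monic := hp.mul (monic_X_pow _)
  have hd : (p * X ^ (n - p.natDegree)).degree = (n : WithBot ℕ) := by
    rw [degree_eq_natDegree hm.ne_zero, hp.natDegree_mul (monic_X_pow _), natDegree_X_pow,
      Nat.add_sub_cancel' hpn]
  rw [add_sub_assoc]
  refine (degree_add_le _ _).trans_lt (max_lt ?_ ?_)
  · exact degree_le_natDegree.trans_lt (by exact_mod_cast hrn)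
  · have := degree_sub_lt_left (p := p * X ^ (n - p.natDegree)) (q := X ^ n) (by rw [hd, degree_X_pow])
      hm.ne_zero (by rw [hm.leadingCoeff, (monic_X_pow n).leadingCoeff])
    rwa [hd] at this

/-- The Chinese remainder theorem for F = (X - y)h. The condition h ≡ 1 mod s(X - y) prescribes F
modulo (X - y)²s, and this modulus is prime to `a` because a(y) is a unit. It is not required that
s(y) be invertible. -/
lemma exists_monic_congr {R : Type*} [CommRing R] {a s : R[X]} {y : R} (ha : a.Monic) (hs : s.Monic)
    (hy : IsUnit (a.eval y)) (has : IsCoprime a s) : ∃ N : ℕ, ∀ n ≥ N, ∃ h : R[X], h.Monic ∧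
      ((X - C y) * h - X ^ n).degree < (n : WithBot ℕ) ∧ s * (X - C y) ∣ h - 1 ∧
      a ∣ (X - C y) * h - 1 := by
  have h1 : IsCoprime (X - C y) a := by
    have := isCoprime_comp_of_dvd (dvd_refl (X - C y)) hy
    rwa [comp_X] at this
  have h2 : IsCoprime ((X - C y) ^ 2 * s) a := (h1.pow_left).mul_left has.symm
  obtain ⟨e, b, heb⟩ := h2
  -- The second argument is a solution F of both congruences; multiples of (X - y)²·s·a may be added
  -- to it freely.
  obtain ⟨N, hN⟩ := exists_add_mul_sub_X_pow_degree_lt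
    ((((monic_X_sub_C y).pow 2).mul hs).mul ha)
    ((X - C y) * (1 + s * (X - C y) * (e * (1 - (X - C y)))))
  refine ⟨N, fun n hn => ?_⟩
  obtain ⟨g, hg⟩ := hN n hn
  have hF : (X - C y) * (1 + s * (X - C y) * (e * (1 - (X - C y)))) +
      (X - C y) ^ 2 * s * a * g =
      (X - C y) * (1 + s * (X - C y) * (e * (1 - (X - C y)) + a * g)) := by ring
  rw [hF] at hg
  refine ⟨1 + s * (X - C y) * (e * (1 - (X - C y)) + a * g), ?_, hg, ?_, ?_⟩
  · refine (monic_X_sub_C y).of_mul_monic_left ?_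
    have := monic_X_pow_add hg
    rwa [add_sub_cancel] at this
  · rw [add_sub_cancel_left]
    exact dvd_mul_right _ _
  · exact ⟨-b * (1 - (X - C y)) + (X - C y) ^ 2 * s * g, by
      linear_combination (1 - (X - C y)) * heb⟩

/-- Split off gcd(c, b) until the remaining factor is prime to `b`, by induction on the degree: `d`
collects the factors whose roots are roots of `b`. -/
lemma exists_eq_mul_isCoprime {K : Type*} [Field K] (b : K[X]) {c : K[X]} (hc : c ≠ 0) :
    ∃ (s d : K[X]) (n : ℕ), c = s * d ∧ s.Monic ∧ IsCoprime s b ∧ d ∣ b ^ n := by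
  classical
  induction hd : c.natDegree using Nat.strong_induction_on generalizing c with
  | _ N ih =>
    by_cases h : IsCoprime c b
    · have hu : IsUnit (C c.leadingCoeff) := by simpa using hc
      have hl : c.leadingCoeff ≠ 0 := leadingCoeff_ne_zero.mpr hc
      -- The leading coefficient goes into `d`, which is then a unit and divides `b ^ 0`.
      refine ⟨c * C c.leadingCoeff⁻¹, C c.leadingCoeff, 0, ?_, monic_mul_leadingCoeff_inv hc,
        ?_, hu.dvd⟩
      · rw [mul_assoc, ← C_mul, inv_mul_cancel₀ hl, C_1, mul_one]
      · exact (isCoprime_mul_unit_right_left (by simpa using hc) _ _).mpr h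
    · have hg : ¬ IsUnit (EuclideanDomain.gcd c b) := by
        rwa [EuclideanDomain.gcd_isUnit_iff]
      obtain ⟨c', hc'⟩ := EuclideanDomain.gcd_dvd_left c b
      have hc'0 : c' ≠ 0 := by rintro rfl; exact hc (by rw [hc', mul_zero])
      have hg0 : EuclideanDomain.gcd c b ≠ 0 := by
        intro h0; exact hc (by rw [hc', h0, zero_mul])
      have hlt : c'.natDegree < N := by
        rw [← hd, hc', natDegree_mul hg0 hc'0]
        have := natDegree_pos_iff_degree_pos.mpr (degree_pos_of_ne_zero_of_nonunit hg0 hg)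
        omega
      obtain ⟨s, d, n, h1, h2, h3, h4⟩ := ih _ hlt hc'0 rfl
      refine ⟨s, EuclideanDomain.gcd c b * d, n + 1, ?_, h2, h3, ?_⟩
      · conv_lhs => rw [hc', h1]
        ring
      · rw [pow_succ, mul_comm]
        exact mul_dvd_mul h4 (EuclideanDomain.gcd_dvd_right c b)

end Polynomial

/-! ### Open subsets of the affine line over a field. -/

namespace FramedCorr

variable (k : Type u) [Field k]

/-- Polynomials over `k` as polynomials over the functions on `Spec k`. -/
noncomputable def specPoly : Polynomial k →+* Polynomial Γ(Spec (.of k), ⊤) :=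
  Polynomial.mapRingHom (Scheme.ΓSpecIso (.of k)).inv.hom

variable {k}

lemma specPoly_surjective : Function.Surjective (specPoly k) :=
  Polynomial.map_surjective _ (ConcreteCategory.bijective_of_isIso
    (Scheme.ΓSpecIso (.of k)).inv).2

/-- The non-vanishing locus in the affine line of a polynomial. -/
noncomputable def nonvanishing (a : Polynomial k) : (affineLine k).Opens :=
  (affineLine k).basicOpen (polyFn _ (specPoly k a))

lemma nonvanishing_mul (a b : Polynomial k) :
    nonvanishing (a * b) = nonvanishing a ⊓ nonvanishing b := by
  rw [nonvanishing, map_mul, map_mul, Scheme.basicOpen_mul]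
  rfl

lemma nonvanishing_zero : nonvanishing (0 : Polynomial k) = ⊥ := by
  rw [nonvanishing, map_zero, map_zero, Scheme.basicOpen_zero]

lemma nonvanishing_le_of_dvd_pow {a b : Polynomial k} {n : ℕ} (h : a ∣ b ^ n) :
    nonvanishing b ≤ nonvanishing a := by
  obtain ⟨c, hc⟩ := h
  have h1 : nonvanishing b ≤ nonvanishing (b ^ n) := by
    rw [nonvanishing, nonvanishing, map_pow, map_pow]
    rcases n.eq_zero_or_pos with rfl | hn
    · rw [pow_zero, Scheme.basicOpen_of_isUnit _ isUnit_one]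
      exact le_top
    · rw [Scheme.basicOpen_pow _ _ hn]
  rw [hc, nonvanishing_mul] at h1
  exact h1.trans inf_le_left

/-- Every open subset of the affine line is the non-vanishing locus of a polynomial. -/
lemma exists_eq_nonvanishing (O : (affineLine k).Opens) : ∃ a, O = nonvanishing a := by
  have : IsPrincipalIdealRing (Polynomial Γ(Spec (.of k), ⊤)) :=
    IsPrincipalIdealRing.of_surjective (specPoly k) specPoly_surjective
  -- Over an affine base `toSpecPoly` is a base change of an isomorphism. A closed set is thus the
  -- zero locus of an ideal of a principal ideal ring.
  have hi : IsIso (toSpecPoly (Spec (.of k))) := by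
    have := (isPullback_toSpecPoly (Spec (.of k))).isIso_fst_of_isIso
    exact this
  obtain ⟨I, hI⟩ := (PrimeSpectrum.isClosed_iff_zeroLocus_ideal _).mp
    (((inv (toSpecPoly (Spec (.of k)))) ⁻¹ᵁ O).isOpen.isClosed_compl)
  obtain ⟨b, hb⟩ := IsPrincipalIdealRing.principal I
  obtain ⟨a, rfl⟩ := specPoly_surjective b
  refine ⟨a, ?_⟩
  rw [nonvanishing, ← toSpecPoly_preimage_basicOpen]
  have h1 : ((inv (toSpecPoly (Spec (.of k)))) ⁻¹ᵁ O) = PrimeSpectrum.basicOpen (specPoly k a) := by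
    ext z
    have h2 : z ∈ ((inv (toSpecPoly (Spec (.of k))) ⁻¹ᵁ O : Set _))ᶜ ↔
        specPoly k a ∈ PrimeSpectrum.asIdeal z := by
      rw [hI, hb, PrimeSpectrum.zeroLocus_span]
      exact Set.singleton_subset_iff
    exact (not_not.symm.trans (not_congr h2)).trans (PrimeSpectrum.mem_basicOpen _ _).symm
  rw [← h1, ← Scheme.Hom.comp_preimage]
  simp

lemma smooth_pr (X : Scheme.{u}) : Smooth (Aff.pr 1 X) := by
  refine MorphismProperty.of_isPullback (isPullback_toSpecPoly X) ?_
  rw [HasRingHomProperty.Spec_iff (P := @Smooth)]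
  have h : Algebra.Smooth Γ(X, ⊤) (Polynomial Γ(X, ⊤)) := ⟨inferInstance, inferInstance⟩
  exact (RingHom.smooth_algebraMap).mpr h

/-- The ideal divided out is generated only by pairs (X, X) with `X` a smooth variety, so the open
part of a pair must be shown to be one. -/
lemma isSmoothVariety_sub (U W : (affineLine k).Opens) : IsSmoothVariety (openPair U W).sub where
  smooth := by
    have := smooth_pr (Spec (.of k))
    change Smooth ((U.ι ⁻¹ᵁ W).ι ≫ U.ι ≫ Aff.pr 1 (Spec (.of k)))
    infer_instance
  separated := by
    change IsSeparated ((U.ι ⁻¹ᵁ W).ι ≫ U.ι ≫ Aff.pr 1 (Spec (.of k)))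
    infer_instance
  quasiCompact := by
    have : IsLocallyNoetherian (affineLine k) :=
      LocallyOfFiniteType.isLocallyNoetherian (Aff.pr 1 (Spec (.of k)))
    change QuasiCompact ((U.ι ⁻¹ᵁ W).ι ≫ U.ι ≫ Aff.pr 1 (Spec (.of k)))
    infer_instance

section
variable {B : Scheme.{u}}

lemma ZF.sigma_comp_id (X : Over B) :
    ZF.comp (Nat.add_zero 1) (ZF.sigma X) (ZF.ofHom (𝟙 X)) = ZF.sigma X := by
  rw [ZF.ofHom, ZF.sigma, ZF.comp_of]
  refine (ZF.of_eq (Corr.equivalent_comp_of_isPullback (Nat.add_zero 1) (Corr.sigma X)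
    (Corr.sigma X) (Corr.ofHom (𝟙 X)) (𝟙 _) (Aff.pr 1 X.left) ?_ ?_ (fun i => ?_)
    (fun i => i.elim0) (fun i => ?_) (fun i => i.elim0) ?_)).symm
  · rw [Corr.ofHom_p_pr]
    change IsPullback (𝟙 (Aff 1 X.left)) (Aff.pr 1 X.left) (Aff.pr 1 X.left) (𝟙 X.left)
    exact IsPullback.of_horiz_isIso ⟨by simp⟩
  · exact Category.id_comp _
  · exact congr($(Scheme.Hom.id_appTop (X := Aff 1 X.left)) _)
  · exact congr($(Scheme.Hom.id_appTop (X := Aff 1 X.left)) _)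
  · exact Category.comp_id _

lemma Pair.Hom.res_eq_id {P : Pair B} (i : Pair.Hom P P) (hi : i.f = 𝟙 P.X) : i.res = 𝟙 P.sub := by
  ext1
  change i.f.left.resLE P.V P.V i.le = 𝟙 P.V.toScheme
  rw [← cancel_mono P.V.ι, Scheme.Hom.resLE_comp_ι, hi]
  exact (Category.comp_id _).trans (Category.id_comp _).symm

/-- Stated through `i.f = 𝟙` so as to apply to the inclusion of an open subset into itself. -/
lemma ZFpr.sigma_comp_ofHom {P : Pair B} (i : Pair.Hom P P) (hi : i.f = 𝟙 P.X) :
    ZFpr.comp (Nat.add_zero 1) (ZFpr.sigma P) (ZFpr.ofHom i) = ZFpr.sigma P := by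
  ext1
  change (ZF.comp _ (ZF.sigma P.X) (ZF.ofHom i.f), ZF.comp _ (ZF.sigma P.sub) (ZF.ofHom i.res)) = _
  rw [i.res_eq_id hi, hi, ZF.sigma_comp_id, ZF.sigma_comp_id]
  rfl

lemma ZFpr.ofHom_comp_sigma {P : Pair B} (i : Pair.Hom P P) (hi : i.f = 𝟙 P.X) :
    ZFpr.comp (Nat.zero_add 1) (ZFpr.ofHom i) (ZFpr.sigma P) = ZFpr.sigma P := by
  refine Eq.trans ?_ (ZFpr.sigma_comp_ofHom i hi)
  ext1
  exact Prod.ext (ZF.sigma_comp i.f) (ZF.sigma_comp i.res)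

end

/-! ### The inclusion of pairs of open subsets. -/

section
variable {k : Type u} [Field k] {U W : (affineLine k).Opens} {a s : Polynomial k}

/-- The inclusion of an open subset in the affine line. -/
noncomputable def toAffineLine (U W : (affineLine k).Opens) :
    (openPair U W).X ⟶ line (Spec (.of k)) :=
  Over.homMk U.ι rfl

instance (U W : (affineLine k).Opens) : IsOpenImmersion (toAffineLine U W).left :=
  inferInstanceAs (IsOpenImmersion U.ι)

lemma cuts_toAffineLine (ha : U = nonvanishing a) (hs : ∀ x ∈ U, x ∈ nonvanishing s → x ∈ W) :
    LineData.Cuts (toAffineLine U W) (specPoly k a) (specPoly k s) where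
  mem_range z hz := ⟨⟨z, ha ▸ hz⟩, rfl⟩
  mem_V y hy := hs y.1 y.2 hy

lemma avoids_toAffineLine (ha : U = nonvanishing a) (hs : ∀ x ∈ U, x ∈ W → x ∈ nonvanishing s) :
    LineData.Avoids (toAffineLine U W) (specPoly k a) (specPoly k s) where
  mem_left x := ha ▸ x.2
  mem_right x hx := hs x.1 x.2 hx

/-- A polynomial over `k` as a polynomial over the functions on `U`. -/
noncomputable def openPoly (U W : (affineLine k).Opens) :
    Polynomial k →+* Polynomial Γ((openPair U W).X.left, ⊤) :=
  (Polynomial.mapRingHom (openPair U W).X.hom.appTop.hom).comp (specPoly k)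

open Polynomial in
/-- For polynomials `a`, `s` over `k` cutting out the pair `(U, U ∩ W)`, a correspondence
given by a polynomial of large degree which is congruent to `1` modulo `a` and to `X - y`
modulo `s` has the class of `σ`. -/
theorem exists_cls_eq_sigma (ha : U = nonvanishing a) (hs : ∀ x ∈ U, x ∈ nonvanishing s ↔ x ∈ W)
    (ham : a.Monic) (hsm : s.Monic) (has : IsCoprime a s) :
    ∃ N : ℕ, ∀ n ≥ N, ∀ (D : LineData (openPair U W).X.left), D.u = 1 → D.γ = X →
      (D.m - X ^ n).degree < (n : WithBot ℕ) → openPoly U W a ∣ D.m - 1 →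
      openPoly U W s ∣ D.m - (X - C (coordOf (toAffineLine U W))) →
      ∀ hD : D.PairMapsTo (P := openPair U W) (toAffineLine U W),
        cls (D.pairCorr (toAffineLine U W) hD) = cls (ZFpr.sigma (openPair U W)) := by
  have hQ := cuts_toAffineLine ha fun x hx => (hs x hx).mp
  have hP := avoids_toAffineLine ha fun x hx => (hs x hx).mpr
  obtain ⟨N, hN⟩ := exists_monic_congr ((ham.map _).map _ : (openPoly U W a).Monic)
    ((hsm.map _).map _ : (openPoly U W s).Monic)
    (isUnit_eval_coordOf (toAffineLine U W) (specPoly k a) hP.mem_left) (has.map (openPoly U W))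
  refine ⟨N, fun n hn D hu hγ hfn hfa hfs hD => ?_⟩
  obtain ⟨h, h1, h2, h3, h4⟩ := hN n hn
  exact LineData.cls_pairCorr_eq_sigma (toAffineLine U W) (isSmoothVariety_sub U W) hQ hP h1 h2 h3 h4
    D hu hγ hfn hfa hfs hD

open Polynomial in
-- Interpolation over the base field. For any `y`, the polynomial p - y q is congruent to 1 modulo
-- `b` and to `X - y` modulo `s`, and has leading term `X ^ n`; the coordinate enters only as a
-- scalar.
lemma exists_monic_congr_one_X {K : Type*} [Field K] {b s : K[X]} (hb : b.Monic) (hs : s.Monic)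
    (h : IsCoprime b s) : ∃ N : ℕ, ∀ n ≥ N, ∃ p q : K[X], (p - X ^ n).degree < (n : WithBot ℕ) ∧
      q.degree < (n : WithBot ℕ) ∧ b ∣ p - 1 ∧ b ∣ q ∧ s ∣ p - X ∧ s ∣ q - 1 := by
  obtain ⟨c, d, hcd⟩ := h
  obtain ⟨N, hN⟩ := exists_add_mul_sub_X_pow_degree_lt (hb.mul hs) (d * s + c * b * X)
  refine ⟨max N ((c * b).natDegree + 1), fun n hn => ?_⟩
  obtain ⟨g, hg⟩ := hN n ((le_max_left _ _).trans hn)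
  refine ⟨d * s + c * b * X + b * s * g, c * b, hg, degree_le_natDegree.trans_lt ?_, ?_,
    dvd_mul_left _ _, ?_, ?_⟩
  · exact_mod_cast Nat.lt_of_succ_le ((le_max_right _ _).trans hn)
  · exact ⟨c * X - c + s * g, by linear_combination hcd⟩
  · exact ⟨d - d * X + b * g, by linear_combination X * hcd⟩
  · exact ⟨-d, by linear_combination hcd⟩

/-- Non-emptiness excludes the zero polynomial, and scaling by a unit does not move the zeros. -/
lemma exists_monic_eq_nonvanishing {O : (affineLine k).Opens}
    (hO : (O : Set (affineLine k)).Nonempty) : ∃ a : Polynomial k, a.Monic ∧ O = nonvanishing a := by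
  obtain ⟨a, rfl⟩ := exists_eq_nonvanishing O
  have ha : a ≠ 0 := by
    rintro rfl
    rw [nonvanishing_zero] at hO
    exact Set.not_nonempty_empty hO
  have hu : IsUnit (Polynomial.C a.leadingCoeff⁻¹) := by simpa using ha
  refine ⟨a * Polynomial.C a.leadingCoeff⁻¹, Polynomial.monic_mul_leadingCoeff_inv ha, ?_⟩
  have h1 : nonvanishing (Polynomial.C a.leadingCoeff⁻¹) = ⊤ :=
    Scheme.basicOpen_of_isUnit _ ((hu.map (specPoly k)).map (polyFn _))
  rw [nonvanishing_mul, h1, inf_top_eq]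

lemma LineData.m_map_sub {X X' : Scheme.{u}} (D : LineData X) (f : X' ⟶ X)
    (r : Polynomial Γ(X, ⊤)) {r' : Polynomial Γ(X', ⊤)} (h : r.map f.appTop.hom = r') :
    (D.m - r).map f.appTop.hom = (D.map f).m - r' := by
  rw [← h]
  exact Polynomial.map_sub _

/-- The degenerate case in which the inclusion of pairs is an identity; σ itself serves as both
inverses. -/
lemma exists_comp_incl_self_eq_sigma {U W : (affineLine k).Opens} (hU : U ≤ U) (hW : W ≤ W) :
    ∃ r l : ZFpr 1 (openPair U W) (openPair U W),
      cls (ZFpr.comp (Nat.add_zero 1) r (ZFpr.ofHom (openPair.incl hU hW))) =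
        cls (ZFpr.sigma (openPair U W)) ∧
      cls (ZFpr.comp (Nat.zero_add 1) (ZFpr.ofHom (openPair.incl hU hW)) l) =
        cls (ZFpr.sigma (openPair U W)) := by
  have hi : (openPair.incl hU hW).f = 𝟙 (openPair U W).X := by
    ext1
    exact Scheme.homOfLE_rfl _ _
  exact ⟨ZFpr.sigma _, ZFpr.sigma _, congrArg cls (ZFpr.sigma_comp_ofHom _ hi),
    congrArg cls (ZFpr.ofHom_comp_sigma _ hi)⟩

open Polynomial in
/-- If `a`, `b`, `s` cut out `U`, `V` and the second components of the pairs, then the inclusion of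
pairs is invertible up to `σ`. -/
theorem exists_comp_incl_eq_sigma {U V W W' : (affineLine k).Opens} {a b s : k[X]} (hVU : V ≤ U)
    (hW : W' ≤ W) (ha : U = nonvanishing a) (hb : V = nonvanishing b)
    (hsU : ∀ x ∈ U, x ∈ nonvanishing s ↔ x ∈ W) (hsV : ∀ x ∈ V, x ∈ nonvanishing s ↔ x ∈ W')
    (ham : a.Monic) (hbm : b.Monic) (hsm : s.Monic) (hab : a ∣ b) (hbs : IsCoprime b s) :
    ∃ r l : ZFpr 1 (openPair U W) (openPair V W'),
      cls (ZFpr.comp (Nat.add_zero 1) r (ZFpr.ofHom (openPair.incl hVU hW))) =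
        cls (ZFpr.sigma (openPair U W)) ∧
      cls (ZFpr.comp (Nat.zero_add 1) (ZFpr.ofHom (openPair.incl hVU hW)) l) =
        cls (ZFpr.sigma (openPair V W')) := by
  have has : IsCoprime a s := hbs.of_isCoprime_of_dvd_left hab
  obtain ⟨N₁, h₁⟩ := exists_cls_eq_sigma ha hsU ham hsm has
  obtain ⟨N₂, h₂⟩ := exists_cls_eq_sigma hb hsV hbm hsm hbs
  obtain ⟨N₃, h₃⟩ := exists_monic_congr_one_X hbm hsm hbs
  -- One degree must serve the interpolation and both comparisons with σ, the one on U and the one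
  -- on V.
  obtain ⟨p, q, hp, hq, hbp, hbq, hsp, hsq⟩ := h₃ (max (max N₁ N₂) N₃) (le_max_right _ _)
  set n := max (max N₁ N₂) N₃ with hn
  let jU := toAffineLine U W
  let jV := toAffineLine V W'
  let π := openPoly U W
  let y := coordOf jU
  have hf : (π p - C y * π q - X ^ n).degree < (n : WithBot ℕ) := by
    have h1 : π p - C y * π q - X ^ n = π (p - X ^ n) - C y * π q := by
      rw [map_sub, map_pow, show π X = X by simp [π, openPoly, specPoly]]
      ring
    have h2 (r : k[X]) (hr : r.degree < (n : WithBot ℕ)) : (π r).degree < (n : WithBot ℕ) :=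
      (degree_map_le.trans degree_map_le).trans_lt hr
    rw [h1]
    refine (degree_sub_le _ _).trans_lt (max_lt (h2 _ hp) ?_)
    rw [← smul_eq_C_mul]
    exact (degree_smul_le _ _).trans_lt (h2 _ hq)
  have hfb : π b ∣ π p - C y * π q - 1 := by
    have h1 := map_dvd π hbp
    rw [map_sub, map_one] at h1
    have := dvd_sub h1 ((map_dvd π hbq).mul_left (C y))
    rwa [sub_right_comm] at this
  have hfs : π s ∣ π p - C y * π q - (X - C y) := by
    have h1 := map_dvd π hsp
    have h2 := (map_dvd π hsq).mul_left (C y)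
    rw [map_sub, show π X = X by simp [π, openPoly, specPoly]] at h1
    rw [map_sub, map_one] at h2
    have := dvd_sub h1 h2
    convert this using 1
    ring
  obtain ⟨D, hDm, hDu, hDγ⟩ : ∃ D : LineData (openPair U W).X.left,
      D.m = π p - C y * π q ∧ D.u = 1 ∧ D.γ = X :=
    ⟨⟨π p - C y * π q, 1, X, by
      have := monic_X_pow_add hf
      rwa [add_sub_cancel] at this, isCoprime_one_right⟩, rfl, rfl, rfl⟩
  rw [← hDm] at hf hfb hfs
  have hD : D.PairMapsTo (P := openPair U W) (Q := openPair V W') jV :=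
    LineData.pairMapsTo_of_dvd (P := openPair U W) (Q := openPair V W') (e := jU) D hDγ
      (cuts_toAffineLine hb fun x hx => (hsV x hx).mp)
      (avoids_toAffineLine ha fun x hx => (hsU x hx).mpr).mem_right hfb hfs
  set inc := openPair.incl hVU hW with h_inc
  have hinc : inc.f ≫ jU = jV := by
    ext1
    exact Scheme.homOfLE_ι _ hVU
  -- The same correspondence is used for `r` and for `l`.
  refine ⟨D.pairCorr (P := openPair U W) (Q := openPair V W') jV hD, D.pairCorr (P := openPair U W) (Q := openPair V W') jV hD, ?_, ?_⟩
  · rw [LineData.pairCorr_comp_ofHom (P := openPair U W) (Q := openPair V W') D jV hD inc jU hinc]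
    exact h₁ n ((le_max_left _ _).trans (le_max_left _ _)) D hDu hDγ hf
      -- With target U only the residue modulo `a` is needed, and it follows from the one modulo
      -- `b`.
      ((map_dvd π hab).trans hfb) hfs _
  · rw [LineData.ofHom_comp_pairCorr (P := openPair U W) (P' := openPair V W') (Q := openPair V W') D jV inc hD]
    -- Polynomials over `k` restrict to themselves and the coordinate of U restricts to that of V,
    -- so the congruences for `D` persist over V.
    have hpoly (r : k[X]) : (π r).map inc.f.left.appTop.hom = openPoly V W' r :=
      map_pullPoly inc.f (specPoly k r)
    refine h₂ n ((le_max_right _ _).trans (le_max_left _ _)) (D.map inc.f.left)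
      ((congrArg (Polynomial.map _) hDu).trans (Polynomial.map_one _))
      ((congrArg (Polynomial.map _) hDγ).trans (Polynomial.map_X _)) ?_ ?_ ?_ _
    · refine (D.m_map_sub inc.f.left (X ^ n) (by rw [Polynomial.map_pow, Polynomial.map_X])) ▸ ?_
      exact degree_map_le.trans_lt hf
    · refine (D.m_map_sub inc.f.left 1 (Polynomial.map_one _)) ▸ ?_
      rw [← hpoly]
      exact Polynomial.map_dvd _ hfb
    · have h1 : (X - C y).map inc.f.left.appTop.hom = X - C (coordOf jV) := by
        rw [Polynomial.map_sub, Polynomial.map_X, Polynomial.map_C, ← hinc, coordOf_comp]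
      refine (D.m_map_sub inc.f.left _ h1) ▸ ?_
      rw [← hpoly]
      exact Polynomial.map_dvd _ hfs

end

end FramedCorr

open Polynomial in
theorem mainTheorem7 {k : Type u} [Field k] [Infinite k] (U V : (affineLine k).Opens)
    (hVU : V ≤ U) (hV : (V : Set (affineLine k)).Nonempty)
    (S : Set (affineLine k)) (hSV : S ⊆ V)
    (hVS : IsOpen ((V : Set (affineLine k)) \ S)) (hUS : IsOpen ((U : Set (affineLine k)) \ S)) :
    let UU : Pair (Spec (.of k)) := openPair U ⟨U \ S, hUS⟩
    let VV : Pair (Spec (.of k)) := openPair V ⟨V \ S, hVS⟩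
    let i : ZFpr 0 VV UU := ZFpr.ofHom (openPair.incl hVU (Set.sdiff_subset_sdiff_left hVU))
    ∃ r l : ZFpr 1 UU VV,
      cls (ZFpr.comp (Nat.add_zero 1) r i) = cls (ZFpr.sigma UU) ∧
      cls (ZFpr.comp (Nat.zero_add 1) i l) = cls (ZFpr.sigma VV) := by
  intro UU VV i
  -- If U - S is empty, then U = V = S and the inclusion is an identity. Otherwise U - S is the
  -- non-vanishing locus of a non-zero polynomial.
  rcases (U \ S : Set (affineLine k)).eq_empty_or_nonempty with h0 | h0
  · obtain rfl : U = V := le_antisymm (fun x hx => hSV (Set.sdiff_eq_empty.mp h0 hx)) hVU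
    exact exists_comp_incl_self_eq_sigma _ _
  obtain ⟨a, ham, ha⟩ := exists_monic_eq_nonvanishing (O := U) (hV.mono hVU)
  obtain ⟨b, hbm, hb, hab⟩ : ∃ b : k[X], b.Monic ∧ V = nonvanishing b ∧ a ∣ b := by
    obtain ⟨b, hbm, hb⟩ := exists_monic_eq_nonvanishing (O := V) hV
    -- Multiplying by `a` forces `a ∣ b` and leaves the locus unchanged, since V lies in U.
    refine ⟨a * b, ham.mul hbm, ?_, dvd_mul_right _ _⟩
    rw [nonvanishing_mul, ← ha, ← hb, inf_eq_right.mpr hVU]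
  obtain ⟨c, hcm, hc⟩ := exists_monic_eq_nonvanishing (O := ⟨U \ S, hUS⟩) h0
  -- `c` also vanishes outside U, so it need not be prime to `b`. Its part `s` prime to `b` still
  -- detects S, because `d` has no zeros on V.
  obtain ⟨s, d, m, hsd, hsm, hsb, hdb⟩ := exists_eq_mul_isCoprime b hcm.ne_zero
  have hc' (x) : (x ∈ U ∧ x ∉ S) ↔ (x ∈ nonvanishing s ∧ x ∈ nonvanishing d) := by
    have : x ∈ (⟨U \ S, hUS⟩ : (affineLine k).Opens) ↔ x ∈ nonvanishing (s * d) := by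
      rw [hc, hsd]
    rwa [nonvanishing_mul] at this
  have hVd : V ≤ nonvanishing d := hb ▸ nonvanishing_le_of_dvd_pow hdb
  have hsV (x) (hx : x ∈ V) : x ∈ nonvanishing s ↔ x ∈ (⟨V \ S, hVS⟩ : (affineLine k).Opens) :=
    ⟨fun h => ⟨hx, ((hc' x).mpr ⟨h, hVd hx⟩).2⟩, fun h => ((hc' x).mp ⟨hVU hx, h.2⟩).1⟩
  have hsU (x) (hx : x ∈ U) : x ∈ nonvanishing s ↔ x ∈ (⟨U \ S, hUS⟩ : (affineLine k).Opens) := by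
    refine ⟨fun h => ⟨hx, fun hxS => ?_⟩, fun h => ((hc' x).mp h).1⟩
    -- A point of S lies in V, where `s` is already known to detect S.
    exact ((hsV x (hSV hxS)).mp h).2 hxS
  exact exists_comp_incl_eq_sigma hVU (Set.sdiff_subset_sdiff_left hVU) ha hb hsU hsV ham hbm hsm hab
    hsb.symm
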